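/- Let $q$ be a prime power, $A=\mathbb F_q[T]$, $\mathfrak p=(\pi)$ a nonzero prime ideal of $A$, $K$ the completion of $\mathbb F_q(T)$ at $\mathfrak p$, $\mathcal O=A_{\mathfrak p}$ its ring of integers with maximal ideal $\mathfrak m$, and $\mathbf C_{\mathfrak p}$ the completion of an algebraic closure of $K$. Let $\tau$ be the operator $x\mapsto x^q$ and $\mathcal O\{\tau\}$ the ring of skew polynomials $\sum a_i\tau^i$ under composition; such an element is also written as the polynomial $\sum a_ix^{q^i}$. Let $r>1$ and let $\Phi:A\to\mathcal O\{\tau\}$, $a\mapsto\Phi_a$, be a Drinfeld module of rank $r$ (so $\Phi_a$ has constant coefficient $a$ and $\tau$-degree $r\deg a$ for $a\neq0$). Assume that $\Phi$ has good reduction modulo $\mathfrak m$, that its height at $\mathfrak p$ is maximal, i.e. equal to $r$ (the lowest power of $\tau$ occurring in $\Phi_\pi$ modulo $\mathfrak m$ is $\tau^{r\deg\pi}$), and that $\Phi_\pi(x)$ is monic. Let $\Phi[\mathfrak p]\subset\mathbf C_{\mathfrak p}$ be the set of common zeros of the $\Phi_a$, $a\in\mathfrak p$. Let $\{\omega_n\}_{n\ge1}$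 be a sequence in $\mathbf C_{\mathfrak p}$ with $\Phi_\pi^n(\omega_n)=0\neq\Phi_\pi^{n-1}(\omega_n)$ and $\Phi_\pi(\omega_{n+1})=\omega_n$ for all $n\ge1$ (powers with respect to composition). Put $K_0=K$ and $K_n=K_{n-1}(\omega_n)$. Let $K((x))_1$ be the set of Laurent series over $K$ with finite principal part which converge on $\{z\in\mathbf C_{\mathfrak p}:0<|z|<1\}$; it contains $\mathcal O((x))$. Theorem. For every $g\in\mathcal O((x))^*$ there is a unique $\mathcal Ng\in K((x))_1$ such that $$\prod_{u\in\Phi[\mathfrak p]}g(x+u)=(\mathcal Ng)\circ\Phi_\pi$$ as functions on $\{z\in\mathbf C_{\mathfrak p}:|z|<1\}\setminus\Phi[\mathfrak p]$; it lies in $\mathcal O((x))^*$, and $\mathcal N$ is an endomorphism of the group $\mathcal O((x))^*$. The evaluation map $ev:f\mapsto\{f(\omega_n)\}_{n\ge1}$ is well defined and gives an isomorphism of groups $$(\mathcal O((x))^*)^{\mathcal N=\mathrm{id}}\simeq\varprojlim_{n\ge1}K_n^*,$$ where the inverse limit is taken with respect to the norm maps $K_{n+1}^*\to K_n^*$. 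-/

import Mathlib

open Polynomial IsDedekindDomain

open scoped LaurentSeries

noncomputable section

namespace DrinfeldColeman

/-! ### The local field, its ring of integers, and the completed algebraic closure -/

section Fields

variable {F : Type*} [Field F]

/-- The completion of `F(T)` at a nonzero prime ideal `𝔭` of `F[T]`. -/
abbrev LocalField (𝔭 : HeightOneSpectrum F[X]) : Type _ := 𝔭.adicCompletion (RatFunc F)

/-- The completion of `F[T]` at `𝔭`: the ring of integers of `LocalField 𝔭`. -/
abbrev Integers (𝔭 : HeightOneSpectrum F[X]) : Type _ := 𝔭.adicCompletionIntegers (RatFunc F)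

variable (𝔭 : HeightOneSpectrum F[X])

/-- The `𝔭`-adic absolute value is normalized to be `2 ^ (-v)`, where `v` is the `𝔭`-adic
valuation with value group `ℤ`; only its equivalence class matters. -/
instance rankOne :
    (Valued.v : Valuation (LocalField 𝔭) (WithZero (Multiplicative ℤ))).RankOne :=
  Valuation.IsRankOneDiscrete.rankOne _ (e := 2) one_lt_two

instance : NontriviallyNormedField (LocalField 𝔭) :=
  Valued.toNontriviallyNormedField (LocalField 𝔭) (WithZero (Multiplicative ℤ))

instance : IsUltrametricDist (LocalField 𝔭) :=
  IsUltrametricDist.isUltrametricDist_of_forall_norm_add_le_max_norm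
    (Valued.isNonarchimedean_norm (LocalField 𝔭) (WithZero (Multiplicative ℤ)))

/-- An algebraic closure of `LocalField 𝔭`, with the unique extension of the absolute value. -/
abbrev AlgCl : Type _ := AlgebraicClosure (LocalField 𝔭)

instance : NormedField (AlgCl 𝔭) := spectralNorm.normedField (LocalField 𝔭) (AlgCl 𝔭)

instance : NormedAlgebra (LocalField 𝔭) (AlgCl 𝔭) := spectralNorm.normedAlgebra _ _

/-- The field `ℂ_𝔭`: the completion of an algebraic closure of `LocalField 𝔭`. -/
abbrev Cp : Type _ := UniformSpace.Completion (AlgCl 𝔭)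

/-- The inclusion of the ring of integers into `ℂ_𝔭`. -/
def integersToCp : Integers 𝔭 →+* Cp 𝔭 :=
  (algebraMap (LocalField 𝔭) (Cp 𝔭)).comp (algebraMap (Integers 𝔭) (LocalField 𝔭))

end Fields

/-! ### Drinfeld modules -/

/-- A Drinfeld `𝔽_q[T]`-module `Φ : 𝔽_q[T] → R{τ}`, where `q` is the cardinality of `F`. An element
`∑ aᵢ τ^i` of `R{τ}` is represented by the polynomial `∑ aᵢ x^(q^i)`, so that the multiplication
of `R{τ}` is the composition of polynomials and its unit is `x`. -/
structure DrinfeldModule (F : Type*) [Field F] [Fintype F] (R : Type*) [CommRing R]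
    [Algebra F[X] R] where
  /-- The polynomial `Φ_a(x)`. -/
  toFun : F[X] → R[X]
  exponent_eq : ∀ a n, (toFun a).coeff n ≠ 0 → ∃ i, n = Fintype.card F ^ i
  map_one : toFun 1 = X
  map_add : ∀ a b, toFun (a + b) = toFun a + toFun b
  map_mul : ∀ a b, toFun (a * b) = (toFun a).comp (toFun b)
  coeff_one : ∀ a, (toFun a).coeff 1 = algebraMap F[X] R a
  nontrivial : ∃ a, toFun a ≠ C (algebraMap F[X] R a) * X

namespace DrinfeldModule

section

variable {F : Type*} [Field F] [Fintype F] {R : Type*} [CommRing R] [Algebra F[X] R]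

/-- `Φ` has rank `r`: the degree of `Φ_a` in `τ` is `r · deg a`. -/
def HasRank (Φ : DrinfeldModule F R) (r : ℕ) : Prop :=
  ∀ a : F[X], a ≠ 0 → (Φ.toFun a).natDegree = Fintype.card F ^ (r * a.natDegree)

/-- `Φ` has good reduction modulo the maximal ideal: its reduction has the same rank. -/
def HasGoodReduction [IsLocalRing R] (Φ : DrinfeldModule F R) : Prop :=
  ∀ a : F[X], a ≠ 0 →
    ((Φ.toFun a).map (IsLocalRing.residue R)).natDegree = (Φ.toFun a).natDegree

/-- `Φ` has height `h` at the prime ideal generated by `π`: the lowest power of `τ` that occurs in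
the reduction of `Φ_π` is `τ^(h · deg π)`. -/
def HasHeight [IsLocalRing R] (Φ : DrinfeldModule F R) (π : F[X]) (h : ℕ) : Prop :=
  ((Φ.toFun π).map (IsLocalRing.residue R)).natTrailingDegree =
    Fintype.card F ^ (h * π.natDegree)

end

variable {F : Type*} [Field F] [Fintype F] {𝔭 : HeightOneSpectrum F[X]}

/-- The value `Φ_a(z)` at `z ∈ ℂ_𝔭`. -/
def act (Φ : DrinfeldModule F (Integers 𝔭)) (a : F[X]) (z : Cp 𝔭) : Cp 𝔭 :=
  (Φ.toFun a).eval₂ (integersToCp 𝔭) z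

/-- The torsion `Φ[𝔭]`: the common zeros in `ℂ_𝔭` of all `Φ_a` with `a ∈ 𝔭`. -/
def torsion (Φ : DrinfeldModule F (Integers 𝔭)) : Set (Cp 𝔭) :=
  {u | ∀ a ∈ 𝔭.asIdeal, Φ.act a u = 0}

end DrinfeldModule

/-! ### Laurent series and the norm operator -/

section Series

variable {F : Type*} [Field F] {𝔭 : HeightOneSpectrum F[X]}

/-- The inclusion of `O((x))` in `K((x))`. -/
def toFieldSeries (f : (Integers 𝔭)⸨X⸩) : (LocalField 𝔭)⸨X⸩ :=
  HahnSeries.map f (algebraMap (Integers 𝔭) (LocalField 𝔭))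

/-- `f` belongs to `K((x))₁`: it converges on the punctured open unit ball of `ℂ_𝔭`. -/
def ConvergesOnPuncturedBall (f : (LocalField 𝔭)⸨X⸩) : Prop :=
  ∀ z : Cp 𝔭, z ≠ 0 → ‖z‖ < 1 →
    Summable fun i : ℤ => algebraMap (LocalField 𝔭) (Cp 𝔭) (f.coeff i) * z ^ i

/-- The value `f(z)` of a Laurent series. -/
def evalAt (f : (LocalField 𝔭)⸨X⸩) (z : Cp 𝔭) : Cp 𝔭 :=
  ∑' i : ℤ, algebraMap (LocalField 𝔭) (Cp 𝔭) (f.coeff i) * z ^ i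

/-- `h` is an element of `K((x))₁` with `∏_{u ∈ Φ[𝔭]} g(x + u) = h ∘ Φ_π`, as functions
on the open unit ball minus `Φ[𝔭]` (where both sides are defined). -/
def IsColemanNorm [Fintype F] (Φ : DrinfeldModule F (Integers 𝔭)) (π : F[X])
    (g h : (LocalField 𝔭)⸨X⸩) : Prop :=
  ConvergesOnPuncturedBall h ∧
    ∀ z : Cp 𝔭, ‖z‖ < 1 → z ∉ Φ.torsion →
      evalAt h (Φ.act π z) = ∏ᶠ u ∈ Φ.torsion, evalAt g (z + u)

end Series

/-! ### The tower and the norm-compatible sequences -/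

section Tower

variable {F : Type*} [Field F] {𝔭 : HeightOneSpectrum F[X]}

/-- The tower `K₀ = K`, `K_{n+1} = K_n(ω_{n+1})` of subfields of `ℂ_𝔭` (`ω 0` is not used). -/
def tower (ω : ℕ → Cp 𝔭) : ℕ → IntermediateField (LocalField 𝔭) (Cp 𝔭)
  | 0 => ⊥
  | n + 1 => (IntermediateField.adjoin (tower ω n) {ω (n + 1)}).restrictScalars (LocalField 𝔭)

theorem tower_le_succ (ω : ℕ → Cp 𝔭) (n : ℕ) : tower ω n ≤ tower ω (n + 1) := fun x hx =>
  (IntermediateField.adjoin (tower ω n) {ω (n + 1)}).algebraMap_mem ⟨x, hx⟩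

/-- The norm map `K_{n+1} → K_n`. -/
def towerNorm (ω : ℕ → Cp 𝔭) (n : ℕ) : tower ω (n + 1) →* tower ω n :=
  letI : Algebra (tower ω n) (tower ω (n + 1)) :=
    (IntermediateField.inclusion (tower_le_succ ω n)).toRingHom.toAlgebra
  Algebra.norm (tower ω n)

/-- The inverse limit of the groups `K_n^*`, `n ≥ 1`, under the norm maps. The entry of index `n`
of a sequence is the element of `K_{n+1}^*`. -/
def normLimit (ω : ℕ → Cp 𝔭) : Subgroup (∀ n : ℕ, (tower ω (n + 1))ˣ) where
  carrier := {a | ∀ n, Units.map (towerNorm ω (n + 1)) (a (n + 1)) = a n}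
  mul_mem' := fun {a b} ha hb n => by
    have h1 := ha n
    have h2 := hb n
    rw [Pi.mul_apply, Pi.mul_apply, _root_.map_mul, h1, h2]
  one_mem' := fun n => by rw [Pi.one_apply, Pi.one_apply, _root_.map_one]
  inv_mem' := fun {a} ha n => by
    have h1 := ha n
    rw [Pi.inv_apply, Pi.inv_apply, map_inv, h1]

end Tower

end DrinfeldColeman

end

/-!
Write `O` for the ring of integers of the local field `K`, `f = Φ_π`, `Q = deg f`, and let `ϖ` be
the image of `π` in `O`. Rank and height being equal, `f` is a monic additive polynomial that
reduces to `x ^ Q` modulo `ϖ` and has linear coefficient `ϖ`, and `x ↦ x ^ Q` is trivial on the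
residue field. The argument uses only these properties (`IsFrobeniusType`), which place it close to
Coleman's original setting of Lubin–Tate groups. Two features of the additive case simplify it: the
zeros of `f(x) - f(z)` are the translates `z + u` with `f(u) = 0`, and `x ↦ x ^ Q` is additive.

*The norm operator.* Repeated Weierstrass division by `f` writes a power series as
`g = ∑_{i < Q} gᵢ(f) xⁱ`. The resultant of `f(X) - y` and `∑ gᵢ(y) Xⁱ` is a power series in `y`
whose value at `y = f(z)` is `∏_u g(z + u)` (`exists_norm`). The absolute values of the torsion
points `θₙ = ω_{n+1}` tend to `1`, so that a power series over `O` is determined by its values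
there (`IsTorsionSequence.eq_of_psEval_eq`), which makes the norm unique and multiplicative. As an
invertible Laurent series over the domain `O` is `x ^ k` times an invertible power series and
`∏_u (x + u) = f`, the operator extends to `O((x))^*` (`lsNorm`). Uniqueness within `K((x))₁` holds
because the zeros of a nonzero Laurent series do not accumulate at `0`
(`eq_zero_of_lsEval_eq_zero`).

*Contraction.* One has `𝒩 g ≡ g` modulo `ϖ`, and `g ≡ 1` modulo `ϖ ^ k` implies `𝒩 g ≡ 1` modulo
`ϖ ^ (k + 1)`. Both follow from estimates of values at the torsion points, as a power series over
`O` is bounded by these values (`IsFrobeniusType.norm_coeff_le_of_norm_psEval_le`). Hence the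
iterates of `𝒩` on an invertible power series form a Cauchy sequence (`C_dvd_iterate_psNorm_sub`).

*The tower.* From `‖θₙ‖ ^ ((Q - 1) Q ^ n) = ‖ϖ‖` one reads off that `K(θₙ) / K` is totally ramified
of degree `(Q - 1) Q ^ n`, with ring of integers `O[θₙ]`, and that the conjugates of `θₙ₊₁` over
`K(θₙ)` are the `θₙ₊₁ + u` (`isNormTower`). The norm operator therefore induces the norm maps of
the tower (`IsNormTower.psEval_psNorm_eq`), and a unit of `O((x))` is fixed by `𝒩` if and only if
its values at the `θₙ` are compatible with the norms.

*Surjectivity.* The terms of a norm-compatible sequence have absolute value `‖θₙ‖ ^ k` for a fixed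
`k`, so that one may assume them to be units `bₙ`. Choose `Pₙ ∈ O[x]` with `Pₙ(θₙ) = bₙ`. By the
contraction property the values of `𝒩 ^ m (P₂ₘ)` at a fixed `θₙ` converge to `bₙ`, and any limit
point of these series, which exists because `O` is compact, interpolates the sequence
(`IsNormTower.exists_psEval_eq`).
-/

noncomputable section

namespace DrinfeldColeman

/-! ### Evaluation of power series with integral coefficients on the open unit ball -/

section PowerSeriesEval

variable {O 𝕜 : Type*} [CommRing O] [NormedField 𝕜]

/-- The value `∑ ι(gₙ) zⁿ` of a power series at a point of a normed field. It is meaningful for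
`‖z‖ < 1` when `ι` takes values in the closed unit ball. -/
def psEval (ι : O →+* 𝕜) (z : 𝕜) (g : PowerSeries O) : 𝕜 :=
  ∑' n : ℕ, ι (PowerSeries.coeff n g) * z ^ n

variable {ι : O →+* 𝕜} {z : 𝕜}

theorem psEval_coe (p : O[X]) : psEval ι z (p : PowerSeries O) = p.eval₂ ι z := by
  rw [psEval, eval₂_eq_sum_range, tsum_eq_sum (s := Finset.range (p.natDegree + 1))]
  · simp
  · intro n hn
    rw [Polynomial.coeff_coe, coeff_eq_zero_of_natDegree_lt (by simpa [Nat.lt_succ_iff] using hn)]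
    simp

variable (hι : ∀ a, ‖ι a‖ ≤ 1) (hz : ‖z‖ < 1)
include hι

omit hι in
theorem norm_mul_pow_le_of_norm_le {b : 𝕜} {c : ℝ} (hb : ‖b‖ ≤ c) (n : ℕ) :
    ‖b * z ^ n‖ ≤ c * ‖z‖ ^ n := by
  rw [norm_mul, norm_pow]
  gcongr

include hz

theorem summable_norm_psEval (g : PowerSeries O) :
    Summable fun n : ℕ => ‖ι (PowerSeries.coeff n g) * z ^ n‖ :=
  Summable.of_nonneg_of_le (fun _ => norm_nonneg _)
    (fun n => norm_mul_pow_le_of_norm_le (hι _) n)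
    ((summable_geometric_of_lt_one (norm_nonneg z) hz).mul_left 1)

variable [CompleteSpace 𝕜]

theorem summable_psEval (g : PowerSeries O) :
    Summable fun n : ℕ => ι (PowerSeries.coeff n g) * z ^ n :=
  (summable_norm_psEval hι hz g).of_norm

/-- Evaluation at a point of the open unit ball, as a ring homomorphism. -/
def psEvalHom : PowerSeries O →+* 𝕜 where
  toFun := psEval ι z
  map_one' := by
    have := psEval_coe (ι := ι) (z := z) 1
    simpa using this
  map_zero' := by
    have := psEval_coe (ι := ι) (z := z) 0
    simpa using this
  map_add' g h := by
    simp only [psEval, map_add, add_mul]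
    exact (summable_psEval hι hz g).tsum_add (summable_psEval hι hz h)
  map_mul' g h := by
    simp only [psEval]
    rw [tsum_mul_tsum_eq_tsum_sum_antidiagonal_of_summable_norm (summable_norm_psEval hι hz g)
      (summable_norm_psEval hι hz h)]
    refine tsum_congr fun n => ?_
    rw [PowerSeries.coeff_mul, map_sum, Finset.sum_mul]
    refine Finset.sum_congr rfl fun p hp => ?_
    rw [← Finset.HasAntidiagonal.mem_antidiagonal.mp hp, map_mul, pow_add]
    ring

theorem psEval_mul (g h : PowerSeries O) :
    psEval ι z (g * h) = psEval ι z g * psEval ι z h := map_mul (psEvalHom hι hz) g h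

theorem psEval_add (g h : PowerSeries O) :
    psEval ι z (g + h) = psEval ι z g + psEval ι z h := map_add (psEvalHom hι hz) g h

theorem psEval_sub (g h : PowerSeries O) :
    psEval ι z (g - h) = psEval ι z g - psEval ι z h := map_sub (psEvalHom hι hz) g h

theorem psEval_one : psEval ι z 1 = 1 := map_one (psEvalHom hι hz)

theorem psEval_zero : psEval ι z 0 = 0 := map_zero (psEvalHom hι hz)

omit hι hz [CompleteSpace 𝕜] in
theorem psEval_C (a : O) : psEval ι z (PowerSeries.C a) = ι a := by
  have := psEval_coe (ι := ι) (z := z) (C a)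
  simpa using this

omit hι hz [CompleteSpace 𝕜] in
theorem psEval_X : psEval ι z PowerSeries.X = z := by
  have := psEval_coe (ι := ι) (z := z) X
  simpa using this

variable [IsUltrametricDist 𝕜]

omit hι [CompleteSpace 𝕜] in
theorem norm_psEval_le {g : PowerSeries O} {c : ℝ} (h : ∀ n, ‖ι (PowerSeries.coeff n g)‖ ≤ c) :
    ‖psEval ι z g‖ ≤ c := by
  have hc : 0 ≤ c := (norm_nonneg _).trans (h 0)
  refine IsUltrametricDist.norm_tsum_le_of_forall_le_of_nonneg hc fun n => ?_
  calc _ ≤ c * ‖z‖ ^ n := norm_mul_pow_le_of_norm_le (h n) n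
    _ ≤ c * 1 := by gcongr; exact pow_le_one₀ (norm_nonneg _) hz.le
    _ = c := mul_one c

omit [CompleteSpace 𝕜] in
theorem norm_psEval_le_one (g : PowerSeries O) : ‖psEval ι z g‖ ≤ 1 :=
  norm_psEval_le hz fun _ => hι _

omit [CompleteSpace 𝕜] hι hz in
theorem norm_pow_sub_pow_le {x y : 𝕜} (hx : ‖x‖ ≤ 1) (hy : ‖y‖ ≤ 1) (n : ℕ) :
    ‖x ^ n - y ^ n‖ ≤ ‖x - y‖ := by
  rw [← (Commute.all x y).geom_sum₂_mul, norm_mul]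
  refine mul_le_of_le_one_left (norm_nonneg _) ?_
  refine IsUltrametricDist.norm_sum_le_of_forall_le_of_nonneg zero_le_one fun i _ => ?_
  rw [norm_mul, norm_pow, norm_pow]
  exact mul_le_one₀ (pow_le_one₀ (norm_nonneg _) hx) (by positivity)
    (pow_le_one₀ (norm_nonneg _) hy)

/-- A power series is Lipschitz on the open unit ball, with the largest absolute value of a
coefficient as a constant. -/
theorem norm_psEval_sub_psEval_le {w : 𝕜} (hw : ‖w‖ < 1) {g : PowerSeries O} {c : ℝ}
    (h : ∀ n, ‖ι (PowerSeries.coeff n g)‖ ≤ c) :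
    ‖psEval ι z g - psEval ι w g‖ ≤ c * ‖z - w‖ := by
  have hc : 0 ≤ c := (norm_nonneg _).trans (h 0)
  rw [psEval, psEval, ← (summable_psEval hι hz g).tsum_sub (summable_psEval hι hw g)]
  refine IsUltrametricDist.norm_tsum_le_of_forall_le_of_nonneg (by positivity) fun n => ?_
  rw [← mul_sub, norm_mul]
  gcongr
  · exact h n
  · exact norm_pow_sub_pow_le hz.le hw.le n

end PowerSeriesEval

/-! ### Additive polynomials of Frobenius type and their torsion points -/

section Datum

variable {O 𝕜 : Type*} [CommRing O] [NormedField 𝕜]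

/-- The properties of `f = Φ_π` and of the inclusion `ι` of the integers `O` of the local field in
`ℂ_𝔭` on which the theory depends. The element `ϖ` is a uniformizer of the discrete valuation ring
`O`, and `f` is a monic additive polynomial over `O` with linear coefficient `ϖ` that reduces to
`x ^ Q` modulo `ϖ`, where the `Q`-th power map is the identity on the residue field. -/
structure IsFrobeniusType (ι : O →+* 𝕜) (ϖ : O) (f : O[X]) : Prop where
  norm_le_one : ∀ a, ‖ι a‖ ≤ 1
  injective : Function.Injective ι
  ne_zero : ϖ ≠ 0
  norm_lt_one : ‖ι ϖ‖ < 1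
  dvd_or_isUnit : ∀ a, ϖ ∣ a ∨ IsUnit a
  dvd_pow_sub_self : ∀ a, ϖ ∣ a ^ f.natDegree - a
  add_pow : ∀ x y : 𝕜, (x + y) ^ f.natDegree = x ^ f.natDegree + y ^ f.natDegree
  monic : f.Monic
  two_lt : 2 < f.natDegree
  coeff_zero : f.coeff 0 = 0
  derivative_eq : derivative f = C ϖ
  dvd_coeff : ∀ i < f.natDegree, ϖ ∣ f.coeff i
  eval_add : ∀ x y : 𝕜, f.eval₂ ι (x + y) = f.eval₂ ι x + f.eval₂ ι y
  splits : (f.map ι).Splits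

/-- A sequence `θ₀, θ₁, …` with `θ₀ ≠ 0`, `f(θ₀) = 0` and `f(θₙ₊₁) = θₙ`: a generator of the Tate
module of `f`. -/
structure IsTorsionSequence (ι : O →+* 𝕜) (f : O[X]) (θ : ℕ → 𝕜) : Prop where
  ne_zero : θ 0 ≠ 0
  eval_zero : f.eval₂ ι (θ 0) = 0
  eval_succ : ∀ n, f.eval₂ ι (θ (n + 1)) = θ n

/-- The finite set of zeros of `f` in `𝕜`. -/
def zeros (ι : O →+* 𝕜) (f : O[X]) : Finset 𝕜 := by
  classical exact (f.map ι).roots.toFinset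

namespace IsFrobeniusType

variable {ι : O →+* 𝕜} {ϖ : O} {f : O[X]} (H : IsFrobeniusType ι ϖ f)
include H

theorem norm_pos : 0 < ‖ι ϖ‖ := by
  rw [norm_pos_iff, map_ne_zero_iff _ H.injective]
  exact H.ne_zero

theorem norm_eq_one_of_isUnit {a : O} (ha : IsUnit a) : ‖ι a‖ = 1 := by
  obtain ⟨b, hb⟩ := ha.exists_right_inv
  refine le_antisymm (H.norm_le_one a) ?_
  have h1 : ‖ι a‖ * ‖ι b‖ = 1 := by rw [← norm_mul, ← map_mul, hb, map_one, norm_one]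
  calc 1 = ‖ι a‖ * ‖ι b‖ := h1.symm
    _ ≤ ‖ι a‖ * 1 := by gcongr; exact H.norm_le_one b
    _ = ‖ι a‖ := mul_one _

theorem norm_le_of_dvd {a b : O} (h : a ∣ b) : ‖ι b‖ ≤ ‖ι a‖ := by
  obtain ⟨c, rfl⟩ := h
  rw [map_mul, norm_mul]
  exact mul_le_of_le_one_right (norm_nonneg _) (H.norm_le_one c)

theorem isUnit_of_norm_eq_one {a : O} (ha : ‖ι a‖ = 1) : IsUnit a := by
  refine (H.dvd_or_isUnit a).resolve_left fun h => ?_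
  exact (H.norm_le_of_dvd h).not_gt (ha ▸ H.norm_lt_one)

theorem pow_strictAnti : StrictAnti fun n : ℕ => ‖ι ϖ‖ ^ n :=
  pow_right_strictAnti₀ H.norm_pos H.norm_lt_one

theorem exists_not_pow_dvd {a : O} (ha : a ≠ 0) : ∃ n, ¬ ϖ ^ n ∣ a := by
  have h0 : 0 < ‖ι a‖ := by rwa [norm_pos_iff, map_ne_zero_iff _ H.injective]
  obtain ⟨n, hn⟩ := exists_pow_lt_of_lt_one h0 H.norm_lt_one
  refine ⟨n, fun h => (H.norm_le_of_dvd h).not_gt ?_⟩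
  rwa [map_pow, norm_pow]

theorem exists_eq_pow_mul {a : O} (ha : a ≠ 0) : ∃ n, ∃ u, IsUnit u ∧ a = ϖ ^ n * u := by
  classical
  have hex := H.exists_not_pow_dvd ha
  have hpos : Nat.find hex ≠ 0 := fun h => by
    have := Nat.find_spec hex
    rw [h] at this
    simp at this
  obtain ⟨m, hm⟩ := Nat.exists_eq_succ_of_ne_zero hpos
  have h1 : ϖ ^ m ∣ a := not_not.mp (Nat.find_min hex (hm ▸ Nat.lt_succ_self m))
  obtain ⟨u, rfl⟩ := h1
  refine ⟨m, u, (H.dvd_or_isUnit u).resolve_left fun hu => ?_, rfl⟩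
  have h2 := Nat.find_spec hex
  rw [hm, Nat.succ_eq_add_one, pow_succ] at h2
  exact h2 (mul_dvd_mul_left _ hu)

theorem exists_norm_eq_pow {a : O} (ha : a ≠ 0) : ∃ n : ℕ, ‖ι a‖ = ‖ι ϖ‖ ^ n := by
  obtain ⟨n, u, hu, rfl⟩ := H.exists_eq_pow_mul ha
  exact ⟨n, by rw [map_mul, norm_mul, H.norm_eq_one_of_isUnit hu, map_pow, norm_pow, mul_one]⟩

theorem norm_le_pow_iff {a : O} {n : ℕ} : ‖ι a‖ ≤ ‖ι ϖ‖ ^ n ↔ ϖ ^ n ∣ a := by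
  refine ⟨fun h => ?_, fun h => by simpa using H.norm_le_of_dvd h⟩
  rcases eq_or_ne a 0 with rfl | ha
  · exact dvd_zero _
  obtain ⟨m, u, hu, rfl⟩ := H.exists_eq_pow_mul ha
  rw [map_mul, norm_mul, H.norm_eq_one_of_isUnit hu, map_pow, norm_pow, mul_one,
    H.pow_strictAnti.le_iff_ge] at h
  exact (pow_dvd_pow ϖ h).mul_right u

theorem norm_le_pow_succ_of_lt {a : O} {n : ℕ} (h : ‖ι a‖ < ‖ι ϖ‖ ^ n) :
    ‖ι a‖ ≤ ‖ι ϖ‖ ^ (n + 1) := by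
  rcases eq_or_ne a 0 with rfl | ha
  · simp
  obtain ⟨m, hm⟩ := H.exists_norm_eq_pow ha
  rw [hm, H.pow_strictAnti.lt_iff_gt] at h
  rw [hm, H.pow_strictAnti.le_iff_ge]
  exact h

theorem exists_eq_C_mul {g : PowerSeries O} {n : ℕ}
    (h : ∀ i, ‖ι (PowerSeries.coeff i g)‖ ≤ ‖ι ϖ‖ ^ n) :
    ∃ g', g = PowerSeries.C (ϖ ^ n) * g' := by
  choose c hc using fun i => H.norm_le_pow_iff.mp (h i)
  refine ⟨PowerSeries.mk c, ?_⟩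
  ext i
  rw [PowerSeries.coeff_C_mul, PowerSeries.coeff_mk, hc]

/-- The content of a nonzero power series can be factored out. -/
theorem exists_primitive {g : PowerSeries O} (hg : g ≠ 0) :
    ∃ m g', g = PowerSeries.C (ϖ ^ m) * g' ∧ ∃ i, IsUnit (PowerSeries.coeff i g') := by
  classical
  obtain ⟨i, hi⟩ : ∃ i, PowerSeries.coeff i g ≠ 0 := by
    by_contra! h
    exact hg (PowerSeries.ext (by simpa using h))
  have hex : ∃ n, ¬ ∀ j, ϖ ^ n ∣ PowerSeries.coeff j g := by
    obtain ⟨n, hn⟩ := H.exists_not_pow_dvd hi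
    exact ⟨n, fun h => hn (h i)⟩
  have hpos : Nat.find hex ≠ 0 := fun h => by
    have := Nat.find_spec hex
    rw [h] at this
    simp at this
  obtain ⟨m, hm⟩ := Nat.exists_eq_succ_of_ne_zero hpos
  have h1 : ∀ j, ϖ ^ m ∣ PowerSeries.coeff j g :=
    not_not.mp (Nat.find_min hex (hm ▸ Nat.lt_succ_self m))
  obtain ⟨g', rfl⟩ := H.exists_eq_C_mul fun j => H.norm_le_pow_iff.mpr (h1 j)
  refine ⟨m, g', rfl, ?_⟩
  have h2 := Nat.find_spec hex
  rw [hm, Nat.succ_eq_add_one] at h2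
  push Not at h2
  obtain ⟨j, hj⟩ := h2
  refine ⟨j, (H.dvd_or_isUnit _).resolve_left fun hu => hj ?_⟩
  rw [PowerSeries.coeff_C_mul, pow_succ]
  exact mul_dvd_mul_left _ hu

/-- Close to the boundary of the unit ball, the first unit coefficient of a power series dominates
all the other terms. -/
theorem norm_psEval_eq [CompleteSpace 𝕜] [IsUltrametricDist 𝕜] {g : PowerSeries O} {i : ℕ}
    (hi : IsUnit (PowerSeries.coeff i g)) (hlt : ∀ j < i, ¬ IsUnit (PowerSeries.coeff j g)) {z : 𝕜}
    (hz : ‖z‖ < 1) (hzi : ‖ι ϖ‖ < ‖z‖ ^ i) : ‖psEval ι z g‖ = ‖z‖ ^ i := by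
  have hpos : 0 < ‖z‖ ^ i := H.norm_pos.trans hzi
  have hmain : ‖psEval ι z (PowerSeries.monomial i (PowerSeries.coeff i g))‖ = ‖z‖ ^ i := by
    have h := psEval_coe (ι := ι) (z := z) (monomial i (PowerSeries.coeff i g))
    rw [Polynomial.coe_monomial] at h
    rw [h, eval₂_monomial, norm_mul, norm_pow, H.norm_eq_one_of_isUnit hi, one_mul]
  have hrest : ‖psEval ι z (g - PowerSeries.monomial i (PowerSeries.coeff i g))‖ < ‖z‖ ^ i := by
    refine lt_of_le_of_lt (b := max ‖ι ϖ‖ (‖z‖ ^ (i + 1))) ?_ (max_lt hzi ?_)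
    · refine IsUltrametricDist.norm_tsum_le_of_forall_le_of_nonneg (by positivity) fun n => ?_
      rw [map_sub, PowerSeries.coeff_monomial, norm_mul, norm_pow]
      rcases lt_trichotomy n i with h | rfl | h
      · rw [if_neg h.ne, sub_zero]
        have h1 := H.norm_le_of_dvd ((H.dvd_or_isUnit _).resolve_right (hlt n h))
        exact le_max_of_le_left
          ((mul_le_mul h1 (pow_le_one₀ (norm_nonneg _) hz.le) (by positivity) (norm_nonneg _)).trans_eq
            (mul_one _))
      · simp
      · rw [if_neg h.ne', sub_zero]
        refine le_max_of_le_right ?_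
        exact (mul_le_of_le_one_left (by positivity) (H.norm_le_one _)).trans
          (pow_le_pow_of_le_one (norm_nonneg _) hz.le h)
    · rw [pow_succ]
      exact mul_lt_of_lt_one_right hpos hz
  have hsum : psEval ι z g = psEval ι z (PowerSeries.monomial i (PowerSeries.coeff i g)) +
      psEval ι z (g - PowerSeries.monomial i (PowerSeries.coeff i g)) := by
    rw [← psEval_add H.norm_le_one hz, add_sub_cancel]
  rw [hsum, IsUltrametricDist.norm_add_eq_max_of_norm_ne_norm (by rw [hmain]; exact hrest.ne'),
    hmain, max_eq_left hrest.le]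

/-- A form of the maximum modulus principle: the coefficients of a power series are bounded by its
values at a sequence of points that approaches the boundary of the unit ball. -/
theorem norm_coeff_le_of_norm_psEval_le [CompleteSpace 𝕜] [IsUltrametricDist 𝕜] {θ : ℕ → 𝕜}
    (h1 : ∀ n, ‖θ n‖ < 1) (hlim : Filter.Tendsto (fun n => ‖θ n‖) Filter.atTop (nhds 1))
    {g : PowerSeries O} {c : ℝ} (hc : ∀ n, ‖psEval ι (θ n) g‖ ≤ c) (i : ℕ) :
    ‖ι (PowerSeries.coeff i g)‖ ≤ c := by
  classical
  rcases eq_or_ne g 0 with rfl | hg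
  · simpa using (norm_nonneg _).trans (hc 0)
  obtain ⟨m, g', rfl, hex⟩ := H.exists_primitive hg
  set k := Nat.find hex
  have hlim' : Filter.Tendsto (fun n => ‖θ n‖ ^ k) Filter.atTop (nhds 1) := by
    simpa using hlim.pow k
  have hev : ∀ᶠ n in Filter.atTop, ‖ι ϖ‖ ^ m * ‖θ n‖ ^ k ≤ c := by
    filter_upwards [hlim'.eventually (lt_mem_nhds H.norm_lt_one)] with n hn
    have h2 := hc n
    rwa [psEval_mul H.norm_le_one (h1 n), psEval_C, norm_mul,
      H.norm_psEval_eq (Nat.find_spec hex) (fun j hj => Nat.find_min hex hj) (h1 n) hn, map_pow,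
      norm_pow] at h2
  have h3 : ‖ι ϖ‖ ^ m ≤ c := by
    have := le_of_tendsto (hlim'.const_mul (‖ι ϖ‖ ^ m)) hev
    rwa [mul_one] at this
  refine le_trans ?_ h3
  rw [PowerSeries.coeff_C_mul, H.norm_le_pow_iff]
  exact dvd_mul_right _ _

theorem eq_of_psEval_eq [CompleteSpace 𝕜] [IsUltrametricDist 𝕜] {θ : ℕ → 𝕜}
    (h1 : ∀ n, ‖θ n‖ < 1) (hlim : Filter.Tendsto (fun n => ‖θ n‖) Filter.atTop (nhds 1))
    {g h : PowerSeries O} (heq : ∀ n, psEval ι (θ n) g = psEval ι (θ n) h) : g = h := by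
  rw [← sub_eq_zero]
  ext i
  have := H.norm_coeff_le_of_norm_psEval_le h1 hlim (g := g - h) (c := 0)
    (fun n => by rw [psEval_sub H.norm_le_one (h1 n), heq, sub_self, norm_zero]) i
  rwa [norm_le_zero_iff, map_eq_zero_iff _ H.injective] at this

/-! ### Values and zeros of `f` -/

theorem coeff_one : f.coeff 1 = ϖ := by
  have := congrArg (fun p => p.coeff 0) H.derivative_eq
  simpa [coeff_derivative] using this

theorem eval_eq_sum (z : 𝕜) : f.eval₂ ι z =
    (∑ i ∈ Finset.range f.natDegree, ι (f.coeff i) * z ^ i) + z ^ f.natDegree := by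
  rw [eval₂_eq_sum_range, Finset.sum_range_succ]
  simp [H.monic.coeff_natDegree]

theorem eval_zero : f.eval₂ ι 0 = 0 := by simp [H.coeff_zero]

theorem eval_neg (x : 𝕜) : f.eval₂ ι (-x) = -f.eval₂ ι x := by
  rw [eq_neg_iff_add_eq_zero, ← H.eval_add, neg_add_cancel, H.eval_zero]

theorem mem_zeros {u : 𝕜} : u ∈ zeros ι f ↔ f.eval₂ ι u = 0 := by
  simp [zeros, Multiset.mem_toFinset, (H.monic.map ι).ne_zero, eval_map]

theorem separable : (f.map ι).Separable := by
  rw [Polynomial.Separable, derivative_map, H.derivative_eq, map_C]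
  refine ⟨0, C (ι ϖ)⁻¹, ?_⟩
  rw [zero_mul, zero_add, ← C_mul, inv_mul_cancel₀ (norm_pos_iff.mp H.norm_pos), C_1]

theorem val_zeros : (zeros ι f).val = (f.map ι).roots := by
  classical
  rw [zeros, Multiset.toFinset_val, Multiset.dedup_eq_self]
  exact nodup_roots H.separable

theorem card_zeros : (zeros ι f).card = f.natDegree := by
  rw [Finset.card, H.val_zeros, ← H.splits.natDegree_eq_card_roots, H.monic.natDegree_map]

theorem eval_eq_prod (x : 𝕜) : f.eval₂ ι x = ∏ u ∈ zeros ι f, (x - u) := by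
  rw [Finset.prod, H.val_zeros, ← eval_map]
  conv_lhs => rw [H.splits.eq_prod_roots_of_monic (H.monic.map ι)]
  rw [eval_multiset_prod, Multiset.map_map]
  simp

theorem zero_mem_zeros : (0 : 𝕜) ∈ zeros ι f := H.mem_zeros.mpr H.eval_zero

theorem neg_mem_zeros {u : 𝕜} (hu : u ∈ zeros ι f) : -u ∈ zeros ι f := by
  rw [H.mem_zeros] at *
  rw [H.eval_neg, hu, neg_zero]

theorem prod_zeros_neg (F : 𝕜 → 𝕜) :
    ∏ u ∈ zeros ι f, F (-u) = ∏ u ∈ zeros ι f, F u :=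
  Finset.prod_nbij' (fun u => -u) (fun u => -u) (fun _ h => H.neg_mem_zeros h)
    (fun _ h => H.neg_mem_zeros h) (fun u _ => neg_neg u) (fun u _ => neg_neg u) fun _ _ => rfl

theorem prod_add_zeros (x : 𝕜) : ∏ u ∈ zeros ι f, (x + u) = f.eval₂ ι x := by
  rw [H.eval_eq_prod, ← H.prod_zeros_neg]
  simp only [sub_eq_add_neg]

theorem monic_map_sub_C (w : 𝕜) : (f.map ι - C w).Monic := by
  refine (H.monic.map ι).sub_of_left ?_
  have : Nontrivial O := ⟨ϖ, 0, H.ne_zero⟩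
  have h2 := H.two_lt
  rw [H.monic.degree_map, degree_eq_natDegree H.monic.ne_zero]
  exact degree_C_le.trans_lt (by exact_mod_cast (by omega : 0 < f.natDegree))

theorem natDegree_map_sub_C (w : 𝕜) : (f.map ι - C w).natDegree = f.natDegree := by
  rw [natDegree_sub_C, H.monic.natDegree_map]

/-- By additivity, the roots of `f(X) - f(z)` are the translates `z + u` of `z`. -/
theorem roots_map_sub_C (z : 𝕜) : (f.map ι - C (f.eval₂ ι z)).roots =
    ((zeros ι f).map (addLeftEmbedding z)).val := by
  symm
  refine Multiset.eq_of_le_of_card_le ?_ ?_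
  · rw [Finset.val_le_iff_val_subset]
    intro x hx
    rw [Finset.mem_val, Finset.mem_map] at hx
    obtain ⟨u, hu, rfl⟩ := hx
    rw [mem_roots (H.monic_map_sub_C _).ne_zero]
    simp [eval_map, H.eval_add, H.mem_zeros.mp hu]
  · refine (card_roots' _).trans_eq ?_
    rw [H.natDegree_map_sub_C, Finset.card_val, Finset.card_map, H.card_zeros]

theorem splits_map_sub_C (z : 𝕜) : (f.map ι - C (f.eval₂ ι z)).Splits := by
  rw [splits_iff_card_roots, H.roots_map_sub_C, H.natDegree_map_sub_C, Finset.card_val,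
    Finset.card_map, H.card_zeros]

theorem map_sub_C_eq_prod (z : 𝕜) : f.map ι - C (f.eval₂ ι z) =
    ∏ s ∈ (zeros ι f).map (addLeftEmbedding z), (X - C s) := by
  rw [Finset.prod, ← H.roots_map_sub_C]
  exact (H.splits_map_sub_C z).eq_prod_roots_of_monic (H.monic_map_sub_C _)

variable [IsUltrametricDist 𝕜]

/-- On the open unit ball `f(z)` is `z ^ Q` up to an error of absolute value exactly `‖ϖ z‖`. -/
theorem norm_eval_sub_pow {z : 𝕜} (hz : ‖z‖ < 1) :
    ‖f.eval₂ ι z - z ^ f.natDegree‖ = ‖ι ϖ‖ * ‖z‖ := by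
  rcases eq_or_ne z 0 with rfl | hz0
  · have := H.two_lt
    rw [H.eval_zero, zero_pow (by omega)]
    simp
  have hzpos : 0 < ‖z‖ := norm_pos_iff.mpr hz0
  rw [H.eval_eq_sum, add_sub_cancel_right]
  obtain ⟨k, hk⟩ : ∃ k, f.natDegree = k + 2 := ⟨f.natDegree - 2, by have := H.two_lt; omega⟩
  rw [hk, Finset.sum_range_succ', Finset.sum_range_succ']
  simp only [zero_add, H.coeff_zero, H.coeff_one, map_zero, zero_mul, add_zero, pow_one]
  have hrest : ‖∑ i ∈ Finset.range k, ι (f.coeff (i + 1 + 1)) * z ^ (i + 1 + 1)‖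
      < ‖ι ϖ * z‖ := by
    refine lt_of_le_of_lt (b := ‖ι ϖ‖ * ‖z‖ ^ 2) ?_ ?_
    · refine IsUltrametricDist.norm_sum_le_of_forall_le_of_nonneg (by positivity) fun i hi => ?_
      rw [norm_mul, norm_pow]
      gcongr ?_ * ?_
      · exact H.norm_le_of_dvd (H.dvd_coeff _ (by rw [hk]; simpa using hi))
      · exact pow_le_pow_of_le_one (norm_nonneg _) hz.le (by omega)
    · rw [norm_mul, pow_two]
      exact mul_lt_mul_of_pos_left (mul_lt_of_lt_one_left hzpos hz) H.norm_pos
  rw [IsUltrametricDist.norm_add_eq_max_of_norm_ne_norm hrest.ne, max_eq_right hrest.le, norm_mul]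

theorem norm_eval_lt_one {z : 𝕜} (hz : ‖z‖ < 1) : ‖f.eval₂ ι z‖ < 1 := by
  have h1 : f.eval₂ ι z = (f.eval₂ ι z - z ^ f.natDegree) + z ^ f.natDegree := by ring
  have h2 := H.two_lt
  rw [h1]
  refine (IsUltrametricDist.norm_add_le_max _ _).trans_lt (max_lt ?_ ?_)
  · rw [H.norm_eval_sub_pow hz]
    exact mul_lt_one_of_nonneg_of_lt_one_left (norm_nonneg _) H.norm_lt_one hz.le
  · rw [norm_pow]
    exact pow_lt_one₀ (norm_nonneg _) hz (by omega)

theorem norm_lt_one_of_norm_eval_lt_one {z : 𝕜} (h : ‖f.eval₂ ι z‖ < 1) : ‖z‖ < 1 := by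
  by_contra! hz
  have hpos : 0 < ‖z‖ := one_pos.trans_le hz
  have h2 := H.two_lt
  have hrest : ‖∑ i ∈ Finset.range f.natDegree, ι (f.coeff i) * z ^ i‖ < ‖z ^ f.natDegree‖ := by
    refine lt_of_le_of_lt (b := ‖ι ϖ‖ * ‖z‖ ^ f.natDegree) ?_ ?_
    · refine IsUltrametricDist.norm_sum_le_of_forall_le_of_nonneg (by positivity) fun i hi => ?_
      rw [Finset.mem_range] at hi
      rw [norm_mul, norm_pow]
      gcongr ?_ * ?_
      · exact H.norm_le_of_dvd (H.dvd_coeff _ hi)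
      · exact pow_le_pow_right₀ hz hi.le
    · rw [norm_pow]
      exact mul_lt_of_lt_one_left (by positivity) H.norm_lt_one
  rw [H.eval_eq_sum, IsUltrametricDist.norm_add_eq_max_of_norm_ne_norm hrest.ne,
    max_eq_right hrest.le, norm_pow] at h
  exact h.not_ge (one_le_pow₀ hz)

theorem norm_lt_one_of_mem_zeros {u : 𝕜} (hu : u ∈ zeros ι f) : ‖u‖ < 1 :=
  H.norm_lt_one_of_norm_eval_lt_one (by rw [H.mem_zeros.mp hu]; simp)

theorem norm_pow_of_mem_zeros {u : 𝕜} (hu : u ∈ zeros ι f) (h0 : u ≠ 0) :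
    ‖u‖ ^ (f.natDegree - 1) = ‖ι ϖ‖ := by
  have h := H.norm_eval_sub_pow (H.norm_lt_one_of_mem_zeros hu)
  have h2 := H.two_lt
  rw [H.mem_zeros.mp hu, zero_sub, norm_neg, norm_pow] at h
  refine mul_right_cancel₀ (norm_ne_zero_iff.mpr h0) ?_
  rw [← pow_succ, Nat.sub_add_cancel (by omega), h]

theorem norm_add_zeros_lt_one {z u : 𝕜} (hz : ‖z‖ < 1) (hu : u ∈ zeros ι f) : ‖z + u‖ < 1 :=
  (IsUltrametricDist.norm_add_le_max _ _).trans_lt (max_lt hz (H.norm_lt_one_of_mem_zeros hu))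

end IsFrobeniusType

namespace IsTorsionSequence

variable {ι : O →+* 𝕜} {ϖ : O} {f : O[X]} (H : IsFrobeniusType ι ϖ f) {θ : ℕ → 𝕜}
  (hθ : IsTorsionSequence ι f θ) [IsUltrametricDist 𝕜]
include H hθ

theorem norm_lt_one (n : ℕ) : ‖θ n‖ < 1 := by
  induction n with
  | zero => exact H.norm_lt_one_of_norm_eval_lt_one (by rw [hθ.eval_zero]; simp)
  | succ n ih => exact H.norm_lt_one_of_norm_eval_lt_one (by rw [hθ.eval_succ]; exact ih)

theorem norm_pow_zero : ‖θ 0‖ ^ (f.natDegree - 1) = ‖ι ϖ‖ :=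
  H.norm_pow_of_mem_zeros (H.mem_zeros.mpr hθ.eval_zero) hθ.ne_zero

theorem norm_eq_of_mem_zeros {u : 𝕜} (hu : u ∈ zeros ι f) (h0 : u ≠ 0) : ‖u‖ = ‖θ 0‖ := by
  have h2 := H.two_lt
  refine (pow_left_inj₀ (norm_nonneg _) (norm_nonneg _) (n := f.natDegree - 1) (by omega)).mp ?_
  rw [H.norm_pow_of_mem_zeros hu h0, norm_pow_zero H hθ]

theorem norm_le_of_mem_zeros {u : 𝕜} (hu : u ∈ zeros ι f) : ‖u‖ ≤ ‖θ 0‖ := by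
  rcases eq_or_ne u 0 with rfl | h0
  · simp
  · exact (norm_eq_of_mem_zeros H hθ hu h0).le

theorem le_norm_and_norm_succ_pow (n : ℕ) :
    ‖ι ϖ‖ ≤ ‖θ n‖ ∧ ‖θ (n + 1)‖ ^ f.natDegree = ‖θ n‖ := by
  have h2 := H.two_lt
  have key (n : ℕ) (h : ‖ι ϖ‖ ≤ ‖θ n‖) : ‖θ (n + 1)‖ ^ f.natDegree = ‖θ n‖ := by
    have h1 := H.norm_eval_sub_pow (norm_lt_one H hθ (n + 1))
    rw [hθ.eval_succ] at h1
    have h3 : ‖θ n - θ (n + 1) ^ f.natDegree‖ < ‖θ n‖ := by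
      rw [h1]
      exact (mul_lt_of_lt_one_right H.norm_pos (norm_lt_one H hθ (n + 1))).trans_le h
    rw [← norm_pow]
    rw [← norm_neg, neg_sub] at h3
    have h4 := IsUltrametricDist.norm_add_eq_max_of_norm_ne_norm h3.ne
    rw [sub_add_cancel, max_eq_right h3.le] at h4
    exact h4
  suffices h : ‖ι ϖ‖ ≤ ‖θ n‖ from ⟨h, key n h⟩
  induction n with
  | zero =>
    rw [← norm_pow_zero H hθ]
    exact pow_le_of_le_one (norm_nonneg _) (norm_lt_one H hθ 0).le (by omega)
  | succ n ih =>
    refine ih.trans ?_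
    rw [← key n ih]
    exact pow_le_of_le_one (norm_nonneg _) (norm_lt_one H hθ (n + 1)).le (by omega)

theorem norm_succ_pow (n : ℕ) : ‖θ (n + 1)‖ ^ f.natDegree = ‖θ n‖ :=
  (le_norm_and_norm_succ_pow H hθ n).2

theorem norm_pos (n : ℕ) : 0 < ‖θ n‖ :=
  H.norm_pos.trans_le (le_norm_and_norm_succ_pow H hθ n).1

theorem ne_zero' (n : ℕ) : θ n ≠ 0 := norm_pos_iff.mp (norm_pos H hθ n)

/-- `θₙ` has absolute value `‖ϖ‖ ^ (1 / ((Q - 1) Q ^ n))`. -/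
theorem norm_pow_eq (n : ℕ) :
    ‖θ n‖ ^ ((f.natDegree - 1) * f.natDegree ^ n) = ‖ι ϖ‖ := by
  induction n with
  | zero => rw [pow_zero, mul_one, norm_pow_zero H hθ]
  | succ n ih =>
    rw [pow_succ, mul_comm (f.natDegree ^ n), ← mul_assoc, mul_comm (_ - 1), mul_assoc, pow_mul,
      norm_succ_pow H hθ, ih]

theorem norm_zero_le (n : ℕ) : ‖θ 0‖ ≤ ‖θ n‖ := by
  have h2 := H.two_lt
  induction n with
  | zero => rfl
  | succ n ih =>
    refine ih.trans ?_
    rw [← norm_succ_pow H hθ n]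
    exact pow_le_of_le_one (norm_nonneg _) (norm_lt_one H hθ (n + 1)).le (by omega)

theorem tendsto_norm : Filter.Tendsto (fun n => ‖θ n‖) Filter.atTop (nhds 1) := by
  have h2 := H.two_lt
  have hE : Filter.Tendsto (fun n : ℕ => (f.natDegree - 1) * f.natDegree ^ n) Filter.atTop
      Filter.atTop :=
    (tendsto_pow_atTop_atTop_of_one_lt (by omega)).const_mul_atTop' (by omega)
  have h3 : Filter.Tendsto
      (fun n : ℕ => ‖ι ϖ‖ ^ (((((f.natDegree - 1) * f.natDegree ^ n : ℕ) : ℝ))⁻¹)) Filter.atTop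
      (nhds (‖ι ϖ‖ ^ (0 : ℝ))) :=
    tendsto_const_nhds.rpow
      (tendsto_inv_atTop_zero.comp (tendsto_natCast_atTop_atTop.comp hE)) (.inl H.norm_pos.ne')
  rw [Real.rpow_zero] at h3
  refine h3.congr fun n => ?_
  rw [← norm_pow_eq H hθ n, Real.pow_rpow_inv_natCast (norm_nonneg _)]
  have : 0 < f.natDegree ^ n := by positivity
  have : 0 < f.natDegree - 1 := by omega
  positivity

theorem eq_of_psEval_eq [CompleteSpace 𝕜] {g h : PowerSeries O}
    (heq : ∀ n, psEval ι (θ n) g = psEval ι (θ n) h) : g = h :=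
  H.eq_of_psEval_eq (norm_lt_one H hθ) (tendsto_norm H hθ) heq

end IsTorsionSequence

end Datum

/-! ### The norm operator on power series -/

section NormOperator

variable {O 𝕜 : Type*} [CommRing O] [NormedField 𝕜] {ι : O →+* 𝕜} {ϖ : O} {f : O[X]}

section Expansion

variable (H : IsFrobeniusType ι ϖ f) [IsAdicComplete (Ideal.span {ϖ}) O]
include H

/-- Weierstrass division by a monic polynomial that is a power of `x` modulo `ϖ`. -/
theorem exists_division {D : O[X]} (hD : D.Monic) (hD' : ∀ i < D.natDegree, ϖ ∣ D.coeff i)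
    (g : PowerSeries O) :
    ∃ (q : PowerSeries O) (r : O[X]), r.degree < D.natDegree ∧ g = D * q + r := by
  have hdist : D.IsDistinguishedAt (Ideal.span {ϖ}) :=
    { monic := hD
      mem := fun {n} hn => Ideal.mem_span_singleton.mpr (hD' n hn) }
  have hne : Ideal.span {ϖ} ≠ ⊤ := by
    rw [Ne, Ideal.span_singleton_eq_top]
    intro h
    exact H.norm_lt_one.ne (H.norm_eq_one_of_isUnit h)
  have hdeg := hdist.coe_natDegree_eq_order_map D 1
    (by rwa [PowerSeries.constantCoeff_one, ← Ideal.ne_top_iff_one]) (by simp)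
  obtain ⟨h1, h2⟩ := (hdist.isWeierstrassDivisorAt hne).isWeierstrassDivisionAt_div_mod g
  refine ⟨_, _, ?_, h2⟩
  rwa [← hdeg, ENat.toNat_natCast] at h1

/-- The `f`-adic expansion of a power series, at the level of values. -/
theorem exists_expansion [CompleteSpace 𝕜] [IsUltrametricDist 𝕜] (g : PowerSeries O) :
    ∃ r : ℕ → O[X], (∀ j, (r j).degree < f.natDegree) ∧ ∀ z : 𝕜, ‖z‖ < 1 →
      HasSum (fun j => (r j).eval₂ ι z * f.eval₂ ι z ^ j) (psEval ι z g) := by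
  choose q r hr hqr using fun g => exists_division H H.monic H.dvd_coeff g
  refine ⟨fun j => r (q^[j] g), fun j => hr _, fun z hz => ?_⟩
  have hfz := H.norm_eval_lt_one hz
  have hsum (n : ℕ) : psEval ι z g =
      ∑ j ∈ Finset.range n, (r (q^[j] g)).eval₂ ι z * f.eval₂ ι z ^ j +
        f.eval₂ ι z ^ n * psEval ι z (q^[n] g) := by
    induction n with
    | zero => simp
    | succ n ih =>
      rw [ih, Finset.sum_range_succ, Function.iterate_succ_apply']
      conv_lhs => rw [hqr (q^[n] g)]
      rw [psEval_add H.norm_le_one hz, psEval_mul H.norm_le_one hz, psEval_coe, psEval_coe]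
      ring
  have hsummable : Summable fun j => (r (q^[j] g)).eval₂ ι z * f.eval₂ ι z ^ j := by
    refine Summable.of_norm_bounded (g := fun j => ‖f.eval₂ ι z‖ ^ j)
      (summable_geometric_of_lt_one (norm_nonneg _) hfz) fun j => ?_
    rw [norm_mul, norm_pow]
    refine mul_le_of_le_one_left (by positivity) ?_
    rw [← psEval_coe]
    exact norm_psEval_le_one H.norm_le_one hz _
  rw [hsummable.hasSum_iff_tendsto_nat]
  have hrest : Filter.Tendsto (fun n => f.eval₂ ι z ^ n * psEval ι z (q^[n] g)) Filter.atTop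
      (nhds 0) := by
    refine squeeze_zero_norm (a := fun n => ‖f.eval₂ ι z‖ ^ n) (fun n => ?_)
      (tendsto_pow_atTop_nhds_zero_of_lt_one (norm_nonneg _) hfz)
    rw [norm_mul, norm_pow]
    exact mul_le_of_le_one_right (by positivity) (norm_psEval_le_one H.norm_le_one hz _)
  have := (tendsto_const_nhds (x := psEval ι z g)).sub hrest
  rw [sub_zero] at this
  refine this.congr fun n => ?_
  rw [hsum n]
  ring

/-- Existence of the norm. If `g = ∑ gᵢ(f) xⁱ` with `i < Q`, the norm is the resultant of
`f(X) - y` and `∑ gᵢ(y) Xⁱ`, a power series in `y`: once `y` is specialized to `f(z)`, the roots of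
the first polynomial are the `z + u`. -/
theorem exists_norm [CompleteSpace 𝕜] [IsUltrametricDist 𝕜] (g : PowerSeries O) :
    ∃ h : PowerSeries O, ∀ z : 𝕜, ‖z‖ < 1 →
      psEval ι (f.eval₂ ι z) h = ∏ u ∈ zeros ι f, psEval ι (z + u) g := by
  classical
  obtain ⟨r, hr, hsum⟩ := exists_expansion H g
  set Q := f.natDegree with hQ
  let G : ℕ → PowerSeries O := fun i => PowerSeries.mk fun j => (r j).coeff i
  let P : (PowerSeries O)[X] := ∑ i ∈ Finset.range Q, C (G i) * X ^ i
  let R : (PowerSeries O)[X] := f.map (PowerSeries.C (R := O)) - C PowerSeries.X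
  refine ⟨resultant R P Q Q, fun z hz => ?_⟩
  have hw := H.norm_eval_lt_one hz
  set w := f.eval₂ ι z with hwdef
  let φ := psEvalHom H.norm_le_one hw
  have hφC : φ.comp (PowerSeries.C (R := O)) = ι := by
    ext a
    exact psEval_C a
  have hφX : φ PowerSeries.X = w := psEval_X
  have hR : R.map φ = f.map ι - C w := by
    rw [Polynomial.map_sub, Polynomial.map_map, hφC, map_C, hφX]
  have hRmonic : (R.map φ).Monic := hR ▸ H.monic_map_sub_C w
  have hRdeg : (R.map φ).natDegree = Q := hR ▸ H.natDegree_map_sub_C w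
  have hroots : (R.map φ).roots = ((zeros ι f).map (addLeftEmbedding z)).val :=
    hR ▸ H.roots_map_sub_C z
  have hsplits : (R.map φ).Splits := hR ▸ H.splits_map_sub_C z
  have hPdeg : (P.map φ).natDegree ≤ Q := by
    refine natDegree_map_le.trans (natDegree_sum_le_of_forall_le _ _ fun i hi => ?_)
    exact (natDegree_C_mul_X_pow_le _ _).trans (Finset.mem_range.mp hi).le
  have hval : psEval ι w (resultant R P Q Q) = φ (resultant R P Q Q) := rfl
  have hres := resultant_eq_prod_eval (R.map φ) (P.map φ) Q hPdeg hsplits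
  rw [hRdeg, hRmonic.leadingCoeff, one_pow, one_mul, hroots] at hres
  rw [hval, ← resultant_map_map, hres, Finset.map_val, Multiset.map_map]
  change ∏ u ∈ zeros ι f, (P.map φ).eval (z + u) = _
  refine Finset.prod_congr rfl fun u hu => ?_
  have hzu := H.norm_add_zeros_lt_one hz hu
  have hfzu : f.eval₂ ι (z + u) = w := by rw [H.eval_add, H.mem_zeros.mp hu, add_zero]
  rw [← (hsum (z + u) hzu).tsum_eq, hfzu]
  have hcoeff (i : ℕ) : φ (G i) = ∑' j, ι ((r j).coeff i) * w ^ j := by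
    change psEval ι w (G i) = _
    simp only [psEval, G, PowerSeries.coeff_mk]
  have hsummable (i : ℕ) : Summable fun j => ι ((r j).coeff i) * w ^ j * (z + u) ^ i := by
    have := (summable_psEval H.norm_le_one hw (G i)).mul_right ((z + u) ^ i)
    simpa only [G, PowerSeries.coeff_mk] using this
  have hlhs : (P.map φ).eval (z + u) =
      ∑ i ∈ Finset.range Q, ∑' j, ι ((r j).coeff i) * w ^ j * (z + u) ^ i := by
    simp only [P, Polynomial.map_sum, Polynomial.map_mul, map_C, Polynomial.map_pow, map_X,
      eval_finsetSum, eval_mul, eval_C, eval_pow, eval_X, hcoeff]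
    refine Finset.sum_congr rfl fun i _ => ?_
    rw [tsum_mul_right]
  rw [hlhs, ← Summable.tsum_finsetSum fun i _ => hsummable i]
  refine tsum_congr fun j => ?_
  rw [eval₂_eq_sum_range' ι (n := Q), Finset.sum_mul]
  · exact Finset.sum_congr rfl fun i _ => by ring
  · have := H.two_lt
    rcases eq_or_ne (r j) 0 with h0 | h0
    · rw [h0, natDegree_zero]
      omega
    · exact (natDegree_lt_iff_degree_lt h0).mpr (hr j)

end Expansion

variable (H : IsFrobeniusType ι ϖ f) [IsAdicComplete (Ideal.span {ϖ}) O] {θ : ℕ → 𝕜}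
  (hθ : IsTorsionSequence ι f θ) [CompleteSpace 𝕜] [IsUltrametricDist 𝕜]

/-- The norm operator `𝒩` on power series. -/
def psNorm : PowerSeries O →* PowerSeries O where
  toFun g := (exists_norm H g).choose
  map_one' := by
    refine IsTorsionSequence.eq_of_psEval_eq H hθ fun n => ?_
    have h1 := IsTorsionSequence.norm_lt_one H hθ (n + 1)
    rw [← hθ.eval_succ n, (exists_norm H 1).choose_spec _ h1,
      psEval_one H.norm_le_one (H.norm_eval_lt_one h1)]
    exact Finset.prod_eq_one fun u hu =>
      psEval_one H.norm_le_one (H.norm_add_zeros_lt_one h1 hu)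
  map_mul' g g' := by
    refine IsTorsionSequence.eq_of_psEval_eq H hθ fun n => ?_
    have h1 := IsTorsionSequence.norm_lt_one H hθ (n + 1)
    rw [← hθ.eval_succ n, (exists_norm H (g * g')).choose_spec _ h1,
      psEval_mul H.norm_le_one (H.norm_eval_lt_one h1), (exists_norm H g).choose_spec _ h1,
      (exists_norm H g').choose_spec _ h1, ← Finset.prod_mul_distrib]
    exact Finset.prod_congr rfl fun u hu =>
      psEval_mul H.norm_le_one (H.norm_add_zeros_lt_one h1 hu) g g'

theorem psEval_psNorm (g : PowerSeries O) {z : 𝕜} (hz : ‖z‖ < 1) :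
    psEval ι (f.eval₂ ι z) (psNorm H hθ g) = ∏ u ∈ zeros ι f, psEval ι (z + u) g :=
  (exists_norm H g).choose_spec z hz

/-! ### Contraction properties of the norm operator -/

omit [CompleteSpace 𝕜] in
theorem norm_prod_sub_pow_le {α : Type*} {s : Finset α} {a : α → 𝕜} {b : 𝕜} {c : ℝ} (hc : 0 ≤ c)
    (hb : ‖b‖ ≤ 1) (ha : ∀ i ∈ s, ‖a i‖ ≤ 1) (hab : ∀ i ∈ s, ‖a i - b‖ ≤ c) :
    ‖∏ i ∈ s, a i - b ^ s.card‖ ≤ c := by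
  classical
  induction s using Finset.induction_on with
  | empty => simpa using hc
  | insert i s hi ih =>
    have h1 := ih (fun j hj => ha j (Finset.mem_insert_of_mem hj))
      (fun j hj => hab j (Finset.mem_insert_of_mem hj))
    have h2 : ∏ j ∈ insert i s, a j - b ^ (insert i s).card =
        a i * (∏ j ∈ s, a j - b ^ s.card) + (a i - b) * b ^ s.card := by
      rw [Finset.prod_insert hi, Finset.card_insert_of_notMem hi]
      ring
    rw [h2]
    refine (IsUltrametricDist.norm_add_le_max _ _).trans (max_le ?_ ?_)
    · rw [norm_mul]
      exact (mul_le_of_le_one_left (norm_nonneg _) (ha i (Finset.mem_insert_self _ _))).trans h1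
    · rw [norm_mul, norm_pow]
      exact (mul_le_of_le_one_right (norm_nonneg _) (pow_le_one₀ (norm_nonneg _) hb)).trans
        (hab i (Finset.mem_insert_self _ _))

omit [IsAdicComplete (Ideal.span {ϖ}) O] [CompleteSpace 𝕜] [IsUltrametricDist 𝕜] in
theorem IsFrobeniusType.C_dvd_iff (H : IsFrobeniusType ι ϖ f) {g : PowerSeries O} {n : ℕ} :
    PowerSeries.C (ϖ ^ n) ∣ g ↔ ∀ i, ‖ι (PowerSeries.coeff i g)‖ ≤ ‖ι ϖ‖ ^ n := by
  refine ⟨?_, H.exists_eq_C_mul⟩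
  rintro ⟨g', rfl⟩ i
  rw [PowerSeries.coeff_C_mul, H.norm_le_pow_iff]
  exact dvd_mul_right _ _

omit [IsAdicComplete (Ideal.span {ϖ}) O] in
include hθ in
/-- A congruence modulo `ϖ ^ (n + 1)` follows from a strict inequality between values, the
absolute value of the coefficients being discrete. -/
theorem IsFrobeniusType.C_dvd_of_norm_psEval_le (H : IsFrobeniusType ι ϖ f) {g : PowerSeries O}
    {n : ℕ} {c : ℝ} (hc : c < ‖ι ϖ‖ ^ n) (hg : ∀ n, ‖psEval ι (θ n) g‖ ≤ c) :
    PowerSeries.C (ϖ ^ (n + 1)) ∣ g := by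
  rw [H.C_dvd_iff]
  intro i
  exact H.norm_le_pow_succ_of_lt ((H.norm_coeff_le_of_norm_psEval_le
    (IsTorsionSequence.norm_lt_one H hθ) (IsTorsionSequence.tendsto_norm H hθ) hg i).trans_lt hc)

omit [IsAdicComplete (Ideal.span {ϖ}) O] [CompleteSpace 𝕜] in
theorem IsFrobeniusType.norm_psEval_le_of_C_dvd (H : IsFrobeniusType ι ϖ f) {g : PowerSeries O}
    {n : ℕ} (h : PowerSeries.C (ϖ ^ n) ∣ g) {z : 𝕜} (hz : ‖z‖ < 1) :
    ‖psEval ι z g‖ ≤ ‖ι ϖ‖ ^ n :=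
  norm_psEval_le hz (H.C_dvd_iff.mp h)

omit [IsAdicComplete (Ideal.span {ϖ}) O] in
theorem norm_psEval_pow_sub_le (H : IsFrobeniusType ι ϖ f) (g : PowerSeries O) {z : 𝕜}
    (hz : ‖z‖ < 1) :
    ‖psEval ι z g ^ f.natDegree - psEval ι (z ^ f.natDegree) g‖ ≤ ‖ι ϖ‖ := by
  have h2 := H.two_lt
  have hzQ : ‖z ^ f.natDegree‖ < 1 := by
    rw [norm_pow]
    exact pow_lt_one₀ (norm_nonneg _) hz (by omega)
  have h1 := (summable_psEval H.norm_le_one hz g).hasSum.map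
    (AddMonoidHom.mk' (fun x : 𝕜 => x ^ f.natDegree) H.add_pow) (continuous_pow f.natDegree)
  have h3 := h1.sub (summable_psEval H.norm_le_one hzQ g).hasSum
  change ‖(∑' n, _) ^ f.natDegree - (∑' n, _)‖ ≤ _
  refine le_of_eq_of_le (congrArg norm h3.tsum_eq.symm) ?_
  refine IsUltrametricDist.norm_tsum_le_of_forall_le_of_nonneg (norm_nonneg _) fun i => ?_
  set a := PowerSeries.coeff i g
  have h4 : (AddMonoidHom.mk' (fun x : 𝕜 => x ^ f.natDegree) H.add_pow) (ι a * z ^ i) -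
      ι a * (z ^ f.natDegree) ^ i = ι (a ^ f.natDegree - a) * (z ^ f.natDegree) ^ i := by
    simp only [AddMonoidHom.mk'_apply, map_sub, map_pow]
    ring
  refine le_of_eq_of_le (congrArg norm h4) ?_
  rw [norm_mul, norm_pow]
  exact (mul_le_of_le_one_right (norm_nonneg _) (pow_le_one₀ (norm_nonneg _) hzQ.le)).trans
    (H.norm_le_of_dvd (H.dvd_pow_sub_self a))

/-- `𝒩 g ≡ g` modulo `ϖ`. -/
theorem C_dvd_psNorm_sub_self (g : PowerSeries O) :
    PowerSeries.C (ϖ ^ (0 + 1)) ∣ psNorm H hθ g - g := by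
  have h0 := IsTorsionSequence.norm_lt_one H hθ 0
  refine H.C_dvd_of_norm_psEval_le hθ (c := ‖θ 0‖) (by simpa using h0) fun n => ?_
  have hz := IsTorsionSequence.norm_lt_one H hθ (n + 1)
  have h2 := H.two_lt
  rw [psEval_sub H.norm_le_one (IsTorsionSequence.norm_lt_one H hθ n), ← hθ.eval_succ n,
    psEval_psNorm H hθ g hz]
  set z := θ (n + 1)
  have hϖ := (IsTorsionSequence.le_norm_and_norm_succ_pow H hθ 0).1
  have hzQ : ‖z ^ f.natDegree‖ < 1 := by
    rw [norm_pow]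
    exact pow_lt_one₀ (norm_nonneg _) hz (by omega)
  have e1 : ‖∏ u ∈ zeros ι f, psEval ι (z + u) g - psEval ι z g ^ f.natDegree‖ ≤ ‖θ 0‖ := by
    rw [← H.card_zeros]
    refine norm_prod_sub_pow_le (norm_nonneg _) (norm_psEval_le_one H.norm_le_one hz g)
      (fun u hu => norm_psEval_le_one H.norm_le_one (H.norm_add_zeros_lt_one hz hu) g)
      fun u hu => ?_
    have := norm_psEval_sub_psEval_le H.norm_le_one (H.norm_add_zeros_lt_one hz hu) hz (g := g)
      fun _ => H.norm_le_one _
    rw [one_mul, add_sub_cancel_left] at this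
    exact this.trans (IsTorsionSequence.norm_le_of_mem_zeros H hθ hu)
  have e2 := (norm_psEval_pow_sub_le H g hz).trans hϖ
  have e3 : ‖psEval ι (z ^ f.natDegree) g - psEval ι (f.eval₂ ι z) g‖ ≤ ‖θ 0‖ := by
    have := norm_psEval_sub_psEval_le H.norm_le_one hzQ (H.norm_eval_lt_one hz) (g := g)
      fun _ => H.norm_le_one _
    rw [one_mul, norm_sub_rev (z ^ _), H.norm_eval_sub_pow hz] at this
    exact (this.trans (mul_le_of_le_one_right (norm_nonneg _) hz.le)).trans hϖ
  have e4 : ∏ u ∈ zeros ι f, psEval ι (z + u) g - psEval ι (f.eval₂ ι z) g =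
      (∏ u ∈ zeros ι f, psEval ι (z + u) g - psEval ι z g ^ f.natDegree) +
      ((psEval ι z g ^ f.natDegree - psEval ι (z ^ f.natDegree) g) +
        (psEval ι (z ^ f.natDegree) g - psEval ι (f.eval₂ ι z) g)) := by ring
  rw [e4]
  exact (IsUltrametricDist.norm_add_le_max _ _).trans (max_le e1
    ((IsUltrametricDist.norm_add_le_max _ _).trans (max_le e2 e3)))

/-- If `g ≡ 1` modulo `ϖ ^ k` with `k ≥ 1`, then `𝒩 g ≡ 1` modulo `ϖ ^ (k + 1)`: all the factors
`g(z + u)` agree with `g(z)` up to an error smaller than `‖ϖ‖ ^ k`, and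
`g(z) ^ Q - 1 = (g(z) - 1) ^ Q`. -/
theorem C_dvd_psNorm_sub_one {g : PowerSeries O} {k : ℕ} (hk : 1 ≤ k)
    (hg : PowerSeries.C (ϖ ^ k) ∣ g - 1) :
    PowerSeries.C (ϖ ^ (k + 1)) ∣ psNorm H hθ g - 1 := by
  have h0 := IsTorsionSequence.norm_lt_one H hθ 0
  have hpk : 0 < ‖ι ϖ‖ ^ k := pow_pos H.norm_pos k
  refine H.C_dvd_of_norm_psEval_le hθ (c := ‖ι ϖ‖ ^ k * ‖θ 0‖)
    (mul_lt_of_lt_one_right hpk h0) fun n => ?_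
  have hz := IsTorsionSequence.norm_lt_one H hθ (n + 1)
  have h2 := H.two_lt
  have hn := IsTorsionSequence.norm_lt_one H hθ n
  rw [psEval_sub H.norm_le_one hn, psEval_one H.norm_le_one hn, ← hθ.eval_succ n,
    psEval_psNorm H hθ g hz]
  set z := θ (n + 1)
  have e1 : ‖∏ u ∈ zeros ι f, psEval ι (z + u) g - psEval ι z g ^ f.natDegree‖ ≤
      ‖ι ϖ‖ ^ k * ‖θ 0‖ := by
    rw [← H.card_zeros]
    refine norm_prod_sub_pow_le (by positivity) (norm_psEval_le_one H.norm_le_one hz g)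
      (fun u hu => norm_psEval_le_one H.norm_le_one (H.norm_add_zeros_lt_one hz hu) g)
      fun u hu => ?_
    have hzu := H.norm_add_zeros_lt_one hz hu
    have := norm_psEval_sub_psEval_le H.norm_le_one hzu hz (H.C_dvd_iff.mp hg)
    rw [psEval_sub H.norm_le_one hzu, psEval_sub H.norm_le_one hz, psEval_one H.norm_le_one hz,
      psEval_one H.norm_le_one hzu, sub_sub_sub_cancel_right, add_sub_cancel_left] at this
    exact this.trans (mul_le_mul_of_nonneg_left
      (IsTorsionSequence.norm_le_of_mem_zeros H hθ hu) hpk.le)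
  have e2 : ‖psEval ι z g ^ f.natDegree - 1‖ ≤ ‖ι ϖ‖ ^ k * ‖θ 0‖ := by
    have h3 : psEval ι z g ^ f.natDegree - 1 = (psEval ι z g - 1) ^ f.natDegree := by
      have := H.add_pow (psEval ι z g - 1) 1
      rw [sub_add_cancel, one_pow] at this
      rw [this, add_sub_cancel_right]
    have h4 := H.norm_psEval_le_of_C_dvd hg hz
    rw [psEval_sub H.norm_le_one hz, psEval_one H.norm_le_one hz] at h4
    rw [h3, norm_pow]
    calc ‖psEval ι z g - 1‖ ^ f.natDegree ≤ (‖ι ϖ‖ ^ k) ^ f.natDegree := by gcongr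
      _ ≤ (‖ι ϖ‖ ^ k) ^ 2 :=
        pow_le_pow_of_le_one hpk.le (pow_le_one₀ (norm_nonneg _) H.norm_lt_one.le) h2.le
      _ = ‖ι ϖ‖ ^ k * ‖ι ϖ‖ ^ k := pow_two _
      _ ≤ ‖ι ϖ‖ ^ k * ‖θ 0‖ := by
        gcongr
        exact (pow_le_of_le_one (norm_nonneg _) H.norm_lt_one.le (by omega)).trans
          (IsTorsionSequence.le_norm_and_norm_succ_pow H hθ 0).1
  have e4 : ∏ u ∈ zeros ι f, psEval ι (z + u) g - 1 =
      (∏ u ∈ zeros ι f, psEval ι (z + u) g - psEval ι z g ^ f.natDegree) +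
      (psEval ι z g ^ f.natDegree - 1) := by ring
  rw [e4]
  exact (IsUltrametricDist.norm_add_le_max _ _).trans (max_le e1 e2)

/-- The iterates of `𝒩` on a unit form a Cauchy sequence. -/
theorem C_dvd_iterate_psNorm_sub {g : PowerSeries O} (hg : IsUnit g) {m j : ℕ} (hmj : m ≤ j) :
    PowerSeries.C (ϖ ^ (m + 1)) ∣ (psNorm H hθ)^[j] g - (psNorm H hθ)^[m] g := by
  obtain ⟨g', hg'⟩ := hg.exists_right_inv
  set c := psNorm H hθ g * g' with hcdef
  have hcg : psNorm H hθ g = c * g := by rw [hcdef, mul_assoc, mul_comm g', hg', mul_one]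
  have hc (i : ℕ) : PowerSeries.C (ϖ ^ (i + 1)) ∣ (psNorm H hθ)^[i] c - 1 := by
    induction i with
    | zero =>
      have h1 : c - 1 = (psNorm H hθ g - g) * g' := by rw [sub_mul, hg']
      rw [Function.iterate_zero_apply, h1]
      exact (C_dvd_psNorm_sub_self H hθ g).mul_right g'
    | succ i ih =>
      rw [Function.iterate_succ_apply']
      exact C_dvd_psNorm_sub_one H hθ (by omega) ih
  induction j, hmj using Nat.le_induction with
  | base => simp
  | succ j hmj ih =>
    have h1 : (psNorm H hθ)^[j + 1] g - (psNorm H hθ)^[m] g =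
        ((psNorm H hθ)^[j] c - 1) * (psNorm H hθ)^[j] g +
          ((psNorm H hθ)^[j] g - (psNorm H hθ)^[m] g) := by
      rw [Function.iterate_succ_apply, hcg, iterate_map_mul]
      ring
    rw [h1]
    refine dvd_add (((_root_.map_dvd _ (pow_dvd_pow ϖ ?_)).trans (hc j)).mul_right _) ih
    omega

end NormOperator

/-! ### Totally ramified generators -/

section Ramified

variable {O K 𝕜 : Type*} [CommRing O] [Field K] [Algebra O K] [IsFractionRing O K] [NormedField 𝕜]
  [Algebra K 𝕜] {ϖ : O} {f : O[X]}

namespace IsFrobeniusType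

variable (H : IsFrobeniusType ((algebraMap K 𝕜).comp (algebraMap O K)) ϖ f)
include H

theorem exists_eq_zpow_mul {b : K} (hb : b ≠ 0) :
    ∃ (m : ℤ) (u : O), IsUnit u ∧ b = algebraMap O K ϖ ^ m * algebraMap O K u := by
  have hinj : Function.Injective (algebraMap O K) := IsFractionRing.injective O K
  obtain ⟨x, y, hy, rfl⟩ := IsFractionRing.div_surjective (A := O) b
  have : Nontrivial O := ⟨ϖ, 0, H.ne_zero⟩
  have hy0 : y ≠ 0 := nonZeroDivisors.ne_zero hy
  have hx0 : x ≠ 0 := by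
    rintro rfl
    simp at hb
  obtain ⟨m, u, hu, rfl⟩ := H.exists_eq_pow_mul hx0
  obtain ⟨n, v, hv, rfl⟩ := H.exists_eq_pow_mul hy0
  obtain ⟨w, hw⟩ := hv.exists_right_inv
  have hϖ : algebraMap O K ϖ ≠ 0 := (map_ne_zero_iff _ hinj).mpr H.ne_zero
  have hvw : algebraMap O K v * algebraMap O K w = 1 := by rw [← map_mul, hw, map_one]
  have hv0 : algebraMap O K v ≠ 0 := left_ne_zero_of_mul_eq_one hvw
  refine ⟨m - n, u * w, hu.mul (IsUnit.of_mul_eq_one_right v hw), ?_⟩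
  rw [zpow_sub₀ hϖ, zpow_natCast, zpow_natCast, map_mul, map_mul, map_mul, map_pow, map_pow,
    eq_inv_of_mul_eq_one_right hvw]
  field_simp

omit [IsFractionRing O K] in
theorem norm_algebraMap_zpow_mul {m : ℤ} {u : O} (hu : IsUnit u) :
    ‖algebraMap K 𝕜 (algebraMap O K ϖ ^ m * algebraMap O K u)‖ =
      ‖algebraMap K 𝕜 (algebraMap O K ϖ)‖ ^ m := by
  have := H.norm_eq_one_of_isUnit hu
  rw [RingHom.comp_apply] at this
  rw [map_mul, norm_mul, this, mul_one, map_zpow₀, norm_zpow]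

/-- An element of the fraction field is integral as soon as its absolute value is smaller than that
of the inverse of the uniformizer. -/
theorem exists_algebraMap_eq {b : K} (hb : ‖algebraMap K 𝕜 (algebraMap O K ϖ)‖ *
    ‖algebraMap K 𝕜 b‖ < 1) : ∃ a, algebraMap O K a = b := by
  rcases eq_or_ne b 0 with rfl | hb0
  · exact ⟨0, map_zero _⟩
  obtain ⟨m, u, hu, rfl⟩ := H.exists_eq_zpow_mul hb0
  have hpos := H.norm_pos
  have hlt := H.norm_lt_one
  rw [RingHom.comp_apply] at hpos hlt
  rw [H.norm_algebraMap_zpow_mul hu, ← zpow_one_add₀ hpos.ne',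
    zpow_lt_one_iff_right_of_lt_one₀ hpos hlt] at hb
  lift m to ℕ using by omega
  exact ⟨ϖ ^ m * u, by simp⟩

variable [IsUltrametricDist 𝕜] {t : 𝕜} {e : ℕ}

omit [IsUltrametricDist 𝕜] in
theorem norm_term_eq (ht : ‖t‖ ^ e = ‖algebraMap K 𝕜 (algebraMap O K ϖ)‖) {b : K}
    (hb : b ≠ 0) (i : ℕ) : ∃ m : ℤ, ‖algebraMap K 𝕜 b * t ^ i‖ = ‖t‖ ^ (e * m + i) := by
  obtain ⟨m, u, hu, rfl⟩ := H.exists_eq_zpow_mul hb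
  refine ⟨m, ?_⟩
  have h0 : ‖t‖ ^ e ≠ 0 := by
    rw [ht]
    exact H.norm_pos.ne'
  rw [norm_mul, H.norm_algebraMap_zpow_mul hu, norm_pow, ← ht]
  rcases Nat.eq_zero_or_pos e with rfl | he
  · simp
  · have h1 : ‖t‖ ≠ 0 := fun h => h0 (by rw [h, zero_pow he.ne'])
    rw [zpow_add₀ h1, zpow_mul, zpow_natCast, zpow_natCast]

/-- If `‖t‖ ^ e = ‖ϖ‖`, the terms of a polynomial in `t` of degree less than `e` have distinct
absolute values, so that the largest one is the absolute value of the sum. -/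
theorem norm_aeval_eq_sup' (ht : ‖t‖ ^ e = ‖algebraMap K 𝕜 (algebraMap O K ϖ)‖) {p : K[X]}
    (hp : p.natDegree < e) (hs : p.support.Nonempty) :
    ‖aeval t p‖ = p.support.sup' hs fun i => ‖algebraMap K 𝕜 (p.coeff i) * t ^ i‖ := by
  have hpos := H.norm_pos
  have hlt := H.norm_lt_one
  rw [RingHom.comp_apply, ← ht] at hpos hlt
  have h1 : ‖t‖ ≠ 0 := fun h => hpos.ne' (by rw [h, zero_pow (by omega)])
  have h2 : ‖t‖ < 1 := by
    by_contra! h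
    exact hlt.not_ge (one_le_pow₀ h)
  rw [aeval_def, eval₂_eq_sum, Polynomial.sum_def]
  refine IsUltrametricDist.norm_sum_eq_sup'_of_pairwise_ne hs fun i hi j hj hij h => hij ?_
  obtain ⟨m, hm⟩ := H.norm_term_eq ht (mem_support_iff.mp hi) i
  obtain ⟨n, hn⟩ := H.norm_term_eq ht (mem_support_iff.mp hj) j
  rw [hm, hn] at h
  have h3 := (zpow_right_strictAnti₀ (by positivity) h2).injective h
  have hi' := le_natDegree_of_mem_supp i hi
  have hj' := le_natDegree_of_mem_supp j hj
  have h4 : (i : ℤ) % e = j % e := by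
    have := congrArg (· % (e : ℤ)) h3
    simpa using this
  rw [Int.emod_eq_of_lt (by omega) (by omega), Int.emod_eq_of_lt (by omega) (by omega)] at h4
  exact_mod_cast h4

theorem norm_coeff_mul_pow_le (ht : ‖t‖ ^ e = ‖algebraMap K 𝕜 (algebraMap O K ϖ)‖) {p : K[X]}
    (hp : p.natDegree < e) (i : ℕ) :
    ‖algebraMap K 𝕜 (p.coeff i) * t ^ i‖ ≤ ‖aeval t p‖ := by
  by_cases hi : i ∈ p.support
  · rw [H.norm_aeval_eq_sup' ht hp ⟨i, hi⟩]
    exact Finset.le_sup' (fun i => ‖algebraMap K 𝕜 (p.coeff i) * t ^ i‖) hi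
  · rw [notMem_support_iff.mp hi]
    simp

theorem exists_norm_aeval_eq_zpow (ht : ‖t‖ ^ e = ‖algebraMap K 𝕜 (algebraMap O K ϖ)‖)
    {p : K[X]} (hp : p.natDegree < e) (h0 : p ≠ 0) : ∃ k : ℤ, ‖aeval t p‖ = ‖t‖ ^ k := by
  have hs := support_nonempty.mpr h0
  obtain ⟨i, hi, h⟩ := Finset.exists_mem_eq_sup' hs fun i => ‖algebraMap K 𝕜 (p.coeff i) * t ^ i‖
  obtain ⟨m, hm⟩ := H.norm_term_eq ht (mem_support_iff.mp hi) i
  exact ⟨_, (H.norm_aeval_eq_sup' ht hp hs).trans (h.trans hm)⟩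

theorem eq_zero_of_aeval_eq_zero (ht : ‖t‖ ^ e = ‖algebraMap K 𝕜 (algebraMap O K ϖ)‖) {p : K[X]}
    (hp : p.natDegree < e) (h : aeval t p = 0) : p = 0 := by
  by_contra h0
  have hpos := H.norm_pos
  rw [RingHom.comp_apply, ← ht] at hpos
  obtain ⟨k, hk⟩ := H.exists_norm_aeval_eq_zpow ht hp h0
  rw [h, norm_zero] at hk
  refine (zpow_ne_zero k fun h1 => hpos.ne' ?_) hk.symm
  rw [h1, zero_pow (by omega)]

theorem norm_aeval_eq_of_norm_eq (ht : ‖t‖ ^ e = ‖algebraMap K 𝕜 (algebraMap O K ϖ)‖) {s : 𝕜}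
    (hst : ‖s‖ = ‖t‖) {p : K[X]} (hp : p.natDegree < e) : ‖aeval s p‖ = ‖aeval t p‖ := by
  rcases eq_or_ne p 0 with rfl | h0
  · simp
  have hs := support_nonempty.mpr h0
  rw [H.norm_aeval_eq_sup' ht hp hs, H.norm_aeval_eq_sup' (hst ▸ ht) hp hs]
  simp only [norm_mul, norm_pow, hst]

/-- The ring of integers of `K(t)` is `O[t]`. -/
theorem exists_map_eq_of_norm_aeval_le_one
    (ht : ‖t‖ ^ e = ‖algebraMap K 𝕜 (algebraMap O K ϖ)‖) {p : K[X]} (hp : p.natDegree < e)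
    (h : ‖aeval t p‖ ≤ 1) : ∃ r : O[X], r.map (algebraMap O K) = p := by
  have hpos := H.norm_pos
  have hlt := H.norm_lt_one
  rw [RingHom.comp_apply, ← ht] at hpos hlt
  have h1 : 0 < ‖t‖ := (norm_nonneg _).lt_of_ne' fun h => hpos.ne' (by rw [h, zero_pow (by omega)])
  have h2 : ‖t‖ < 1 := by
    by_contra! h
    exact hlt.not_ge (one_le_pow₀ h)
  have hlift : p ∈ lifts (algebraMap O K) := by
    rw [lifts_iff_coeff_lifts]
    intro i
    by_cases hi : i ∈ p.support
    · have hi' := le_natDegree_of_mem_supp i hi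
      refine H.exists_algebraMap_eq ?_
      have h3 := (H.norm_coeff_mul_pow_le ht hp i).trans h
      rw [norm_mul, norm_pow] at h3
      have hb : 0 < ‖algebraMap K 𝕜 (p.coeff i)‖ := by
        rw [norm_pos_iff, map_ne_zero_iff _ (algebraMap K 𝕜).injective]
        exact mem_support_iff.mp hi
      rw [← ht, mul_comm]
      refine (mul_lt_mul_of_pos_left ?_ hb).trans_le h3
      exact pow_lt_pow_right_of_lt_one₀ h1 h2 (by omega)
    · rw [notMem_support_iff.mp hi]
      exact ⟨0, map_zero _⟩
  exact (mem_lifts _).mp hlift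

end IsFrobeniusType

end Ramified

/-! ### Values of power series at torsion points are values of polynomials -/

section Iterate

variable {O 𝕜 : Type*} [CommRing O] [NormedField 𝕜] {ι : O →+* 𝕜} {ϖ : O} {f : O[X]}

theorem dvd_coeff_of_map_eq_X_pow {D : O[X]}
    (h : D.map (Ideal.Quotient.mk (Ideal.span {ϖ})) = X ^ D.natDegree) {i : ℕ}
    (hi : i < D.natDegree) : ϖ ∣ D.coeff i := by
  have := congrArg (fun p => p.coeff i) h
  rw [← Ideal.mem_span_singleton, ← Ideal.Quotient.eq_zero_iff_mem]
  simpa [coeff_map, coeff_X_pow, hi.ne] using this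

theorem eval₂_iterate_comp (n : ℕ) (z : 𝕜) :
    (f.comp^[n] X).eval₂ ι z = (fun x => f.eval₂ ι x)^[n] z := by
  induction n with
  | zero => simp
  | succ n ih =>
    rw [Function.iterate_succ_apply', Function.iterate_succ_apply', eval₂_comp, ih]

namespace IsFrobeniusType

variable (H : IsFrobeniusType ι ϖ f)
include H

theorem map_eq_X_pow : f.map (Ideal.Quotient.mk (Ideal.span {ϖ})) = X ^ f.natDegree := by
  have hdist : f.IsDistinguishedAt (Ideal.span {ϖ}) :=
    { monic := H.monic
      mem := fun {n} hn => Ideal.mem_span_singleton.mpr (H.dvd_coeff n hn) }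
  exact hdist.map_eq_X_pow

theorem iterate_comp (n : ℕ) : (f.comp^[n] X).Monic ∧ (f.comp^[n] X).natDegree = f.natDegree ^ n ∧
    (f.comp^[n] X).map (Ideal.Quotient.mk (Ideal.span {ϖ})) = X ^ f.natDegree ^ n := by
  have : Nontrivial O := ⟨ϖ, 0, H.ne_zero⟩
  have h2 := H.two_lt
  induction n with
  | zero => simp
  | succ n ih =>
    obtain ⟨h3, h4, h5⟩ := ih
    have h6 : (f.comp^[n] X).natDegree ≠ 0 := by
      rw [h4]
      positivity
    rw [Function.iterate_succ_apply']
    refine ⟨H.monic.comp h3 h6, ?_, ?_⟩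
    · rw [natDegree_comp_eq_of_mul_ne_zero, h4, pow_succ']
      rw [H.monic.leadingCoeff, h3.leadingCoeff, one_pow, one_mul]
      exact one_ne_zero
    · rw [map_comp, h5, H.map_eq_X_pow, X_pow_comp, ← pow_mul, ← pow_succ]

theorem exists_psEval_eq_eval₂ [IsAdicComplete (Ideal.span {ϖ}) O] [CompleteSpace 𝕜] (n : ℕ)
    (g : PowerSeries O) : ∃ r : O[X], ∀ z : 𝕜, ‖z‖ < 1 → (fun x => f.eval₂ ι x)^[n] z = 0 →
      psEval ι z g = r.eval₂ ι z := by
  obtain ⟨h3, h4, h5⟩ := H.iterate_comp n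
  obtain ⟨q, r, -, hqr⟩ := exists_division H h3
    (fun i hi => dvd_coeff_of_map_eq_X_pow (by rw [h5, h4]) hi) g
  refine ⟨r, fun z hz h0 => ?_⟩
  rw [hqr, psEval_add H.norm_le_one hz, psEval_mul H.norm_le_one hz, psEval_coe, psEval_coe,
    eval₂_iterate_comp, h0, zero_mul, zero_add]

end IsFrobeniusType

theorem IsTorsionSequence.iterate_eq_zero {θ : ℕ → 𝕜} (H : IsFrobeniusType ι ϖ f)
    (hθ : IsTorsionSequence ι f θ) (n : ℕ) {u : 𝕜} (hu : u ∈ zeros ι f) :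
    (fun x => f.eval₂ ι x)^[n + 2] (θ n + u) = 0 := by
  have h (n : ℕ) : (fun x => f.eval₂ ι x)^[n + 1] (θ n) = 0 := by
    induction n with
    | zero => exact hθ.eval_zero
    | succ n ih => rw [Function.iterate_succ_apply, hθ.eval_succ, ih]
  rw [Function.iterate_succ_apply, H.eval_add, H.mem_zeros.mp hu, add_zero,
    ← Function.iterate_succ_apply (f := fun x => f.eval₂ ι x), Function.iterate_succ_apply', h,
    H.eval_zero]

end Iterate

/-! ### Interpolation of norm-compatible sequences -/

section Interpolation

variable {O K 𝕜 : Type*} [CommRing O] [Field K] [Algebra O K] [NormedField 𝕜]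
  [Algebra K 𝕜] {ϖ : O} {f : O[X]}

/-- The structure of the tower `Lₙ = K(θₙ)` and of its norm maps that is needed to interpolate
norm-compatible sequences: the conjugates of `θₙ₊₁` over `Lₙ` are the `θₙ₊₁ + u`, where `u` runs
over the zeros of `f`. -/
structure IsNormTower (f : O[X]) (θ : ℕ → 𝕜) (L : ℕ → IntermediateField K 𝕜)
    (Nm : ∀ n, L (n + 1) →* L n) : Prop where
  mem : ∀ n, θ n ∈ L n
  exists_aeval : ∀ n, ∀ x ∈ L n, ∃ p : K[X],
    p.natDegree < (f.natDegree - 1) * f.natDegree ^ n ∧ aeval (θ n) p = x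
  norm_eq : ∀ n (x : L (n + 1)) (p : K[X]), (x : 𝕜) = aeval (θ (n + 1)) p →
    (Nm n x : 𝕜) = ∏ u ∈ zeros ((algebraMap K 𝕜).comp (algebraMap O K)) f,
      aeval (θ (n + 1) + u) p

variable (H : IsFrobeniusType ((algebraMap K 𝕜).comp (algebraMap O K)) ϖ f)
  {θ : ℕ → 𝕜} (hθ : IsTorsionSequence ((algebraMap K 𝕜).comp (algebraMap O K)) f θ)
  {L : ℕ → IntermediateField K 𝕜} {Nm : ∀ n, L (n + 1) →* L n}

theorem eval₂_eq_aeval_map (r : O[X]) (z : 𝕜) :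
    r.eval₂ ((algebraMap K 𝕜).comp (algebraMap O K)) z = aeval z (r.map (algebraMap O K)) := by
  rw [aeval_def, eval₂_map]

theorem exists_psEval_eq_aeval [IsAdicComplete (Ideal.span {ϖ}) O] [CompleteSpace 𝕜]
    [IsUltrametricDist 𝕜] (H : IsFrobeniusType ((algebraMap K 𝕜).comp (algebraMap O K)) ϖ f)
    (hθ : IsTorsionSequence ((algebraMap K 𝕜).comp (algebraMap O K)) f θ) (n : ℕ)
    (g : PowerSeries O) : ∃ p : K[X], ∀ u ∈ zeros ((algebraMap K 𝕜).comp (algebraMap O K)) f,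
      psEval ((algebraMap K 𝕜).comp (algebraMap O K)) (θ n + u) g = aeval (θ n + u) p := by
  obtain ⟨r, hr⟩ := H.exists_psEval_eq_eval₂ (n + 2) g
  refine ⟨r.map (algebraMap O K), fun u hu => ?_⟩
  rw [hr _ (H.norm_add_zeros_lt_one (hθ.norm_lt_one H n) hu) (hθ.iterate_eq_zero H n hu),
    eval₂_eq_aeval_map]

namespace IsNormTower

variable (T : IsNormTower f θ L Nm)

include hθ in
theorem norm_theta [IsUltrametricDist 𝕜]
    (H : IsFrobeniusType ((algebraMap K 𝕜).comp (algebraMap O K)) ϖ f)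
    (T : IsNormTower f θ L Nm) (n : ℕ) :
    Nm n ⟨θ (n + 1), T.mem (n + 1)⟩ = ⟨θ n, T.mem n⟩ := by
  refine Subtype.ext ?_
  rw [T.norm_eq n _ X (by simp)]
  simp only [aeval_X]
  rw [H.prod_add_zeros, hθ.eval_succ]

variable [IsAdicComplete (Ideal.span {ϖ}) O] [CompleteSpace 𝕜] [IsUltrametricDist 𝕜]

include H hθ T in
theorem psEval_mem (n : ℕ) (g : PowerSeries O) :
    psEval ((algebraMap K 𝕜).comp (algebraMap O K)) (θ n) g ∈ L n := by
  obtain ⟨p, hp⟩ := exists_psEval_eq_aeval H hθ n g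
  have := hp 0 H.zero_mem_zeros
  rw [add_zero] at this
  rw [this, aeval_def, eval₂_eq_sum]
  exact sum_mem fun i _ => mul_mem ((L n).algebraMap_mem _) (pow_mem (T.mem n) i)

include T in
/-- The norm operator on power series induces the norm maps of the tower. -/
theorem psEval_psNorm_eq (n : ℕ) (g : PowerSeries O) (x : L (n + 1))
    (hx : psEval ((algebraMap K 𝕜).comp (algebraMap O K)) (θ (n + 1)) g = x) :
    psEval ((algebraMap K 𝕜).comp (algebraMap O K)) (θ n) (psNorm H hθ g) = Nm n x := by
  obtain ⟨p, hp⟩ := exists_psEval_eq_aeval H hθ (n + 1) g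
  have h0 := hp 0 H.zero_mem_zeros
  rw [add_zero, hx] at h0
  have h1 := psEval_psNorm H hθ g (IsTorsionSequence.norm_lt_one H hθ (n + 1))
  rw [hθ.eval_succ] at h1
  rw [T.norm_eq n x p h0, h1]
  exact Finset.prod_congr rfl hp

include T in
theorem psEval_iterate_psNorm_eq {b : ∀ n, L n} (hb : ∀ n, Nm n (b (n + 1)) = b n) (n j : ℕ)
    (g : PowerSeries O)
    (hg : psEval ((algebraMap K 𝕜).comp (algebraMap O K)) (θ (n + j)) g = b (n + j)) :
    psEval ((algebraMap K 𝕜).comp (algebraMap O K)) (θ n) ((psNorm H hθ)^[j] g) = b n := by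
  induction j generalizing g with
  | zero => exact hg
  | succ j ih =>
    rw [Function.iterate_succ_apply]
    refine ih _ ?_
    rw [T.psEval_psNorm_eq H hθ (n + j) g (b (n + j + 1)) hg, hb]

include H hθ T in
/-- A norm-compatible sequence of elements of absolute value one is interpolated by a power
series: a limit point of the series `𝒩 ^ m (P₂ₘ)`, where `Pₙ` is a polynomial that takes the
prescribed value at `θₙ`. -/
theorem exists_psEval_eq [IsFractionRing O K] [TopologicalSpace O] [CompactSpace O]
    (hcont : Continuous ((algebraMap K 𝕜).comp (algebraMap O K))) {b : ∀ n, L n}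
    (hb : ∀ n, Nm n (b (n + 1)) = b n) (hb1 : ∀ n, ‖(b n : 𝕜)‖ = 1) :
    ∃ g : PowerSeries O, IsUnit g ∧
      ∀ n, psEval ((algebraMap K 𝕜).comp (algebraMap O K)) (θ n) g = b n := by
  set ι := (algebraMap K 𝕜).comp (algebraMap O K) with hι
  have hθ1 := IsTorsionSequence.norm_lt_one H hθ
  have hunit {g : PowerSeries O} {n : ℕ} (hg : psEval ι (θ n) g = b n) : IsUnit g := by
    rw [PowerSeries.isUnit_iff_constantCoeff]
    refine H.isUnit_of_norm_eq_one ?_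
    have h0 : psEval ι 0 g = ι (PowerSeries.constantCoeff g) := by
      rw [psEval, tsum_eq_single 0 fun n hn => by rw [zero_pow hn, mul_zero]]
      simp
    have h1 := norm_psEval_sub_psEval_le H.norm_le_one (hθ1 n) (w := 0) (by simp) (g := g)
      fun _ => H.norm_le_one _
    rw [one_mul, sub_zero, hg, h0] at h1
    have h2 := IsUltrametricDist.norm_eq_of_add_norm_lt_max
      (x := (b n : 𝕜)) (y := -ι (PowerSeries.constantCoeff g)) (by
        rw [← sub_eq_add_neg, hb1]
        exact (h1.trans_lt (hθ1 n)).trans_le (le_max_left _ _))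
    rw [hb1, norm_neg] at h2
    exact h2.symm
  have hP (n : ℕ) : ∃ P : PowerSeries O, psEval ι (θ n) P = b n := by
    obtain ⟨p, hp, hpb⟩ := T.exists_aeval n (b n) (b n).2
    obtain ⟨r, rfl⟩ := H.exists_map_eq_of_norm_aeval_le_one
      (IsTorsionSequence.norm_pow_eq H hθ n) hp (by rw [hpb, hb1])
    exact ⟨r, by rw [psEval_coe, eval₂_eq_aeval_map, hpb]⟩
  choose P hP using hP
  let F : ℕ → PowerSeries O := fun m => (psNorm H hθ)^[m] (P (2 * m))
  have hF (n m : ℕ) (hnm : n ≤ m) : ‖psEval ι (θ n) (F m) - b n‖ ≤ ‖ι ϖ‖ ^ (m + 1) := by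
    have h1 : psEval ι (θ n) ((psNorm H hθ)^[2 * m - n] (P (2 * m))) = b n := by
      refine T.psEval_iterate_psNorm_eq H hθ hb n (2 * m - n) _ ?_
      rw [show n + (2 * m - n) = 2 * m by omega]
      exact hP _
    rw [← h1, norm_sub_rev, ← psEval_sub H.norm_le_one (hθ1 n)]
    exact H.norm_psEval_le_of_C_dvd
      (C_dvd_iterate_psNorm_sub H hθ (hunit (hP (2 * m))) (by omega)) (hθ1 n)
  -- The coefficients are extracted along an ultrafilter, the space of sequences being compact.
  let c : ℕ → ℕ → O := fun m i => PowerSeries.coeff i (F m)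
  let U : Ultrafilter (ℕ → O) := (Filter.hyperfilter ℕ).map c
  have hlim : Filter.Tendsto c (Filter.hyperfilter ℕ) (nhds U.lim) := U.le_nhds_lim
  have heval (n : ℕ) : psEval ι (θ n) (PowerSeries.mk U.lim) = b n := by
    have hcontF : Continuous fun a : ℕ → O => ∑' i, ι (a i) * θ n ^ i := by
      refine continuous_tsum (u := fun i => ‖θ n‖ ^ i)
        (fun i => (hcont.comp (continuous_apply i)).mul continuous_const)
        (summable_geometric_of_lt_one (norm_nonneg _) (hθ1 n)) fun i a => ?_
      have := norm_mul_pow_le_of_norm_le (z := θ n) (H.norm_le_one (a i)) i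
      rwa [one_mul] at this
    have h1 := (hcontF.tendsto U.lim).comp hlim
    have h2 : Filter.Tendsto (fun m => psEval ι (θ n) (F m)) (Filter.hyperfilter ℕ)
        (nhds (b n : 𝕜)) := by
      have hle : (Filter.hyperfilter ℕ : Filter ℕ) ≤ Filter.atTop :=
        Nat.hyperfilter_le_atTop
      refine Filter.Tendsto.mono_left ?_ hle
      rw [tendsto_iff_norm_sub_tendsto_zero]
      refine squeeze_zero' (Filter.Eventually.of_forall fun _ => norm_nonneg _)
        (g := fun m => ‖ι ϖ‖ ^ (m + 1)) ?_ ?_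
      · filter_upwards [Filter.eventually_ge_atTop n] with m hm using hF n m hm
      · exact (tendsto_pow_atTop_nhds_zero_of_lt_one (norm_nonneg _) H.norm_lt_one).comp
          (Filter.tendsto_add_atTop_nat 1)
    have h3 := tendsto_nhds_unique h1 h2
    simpa only [psEval, PowerSeries.coeff_mk] using h3
  exact ⟨_, hunit (heval 0), heval⟩

include H hθ T in
/-- Every norm-compatible sequence of units is interpolated by `x ^ k` times an invertible power
series: the absolute value of its `n`-th term is `‖θₙ‖ ^ k` with `k` independent of `n`. -/
theorem exists_zpow_mul_psEval_eq [IsFractionRing O K] [TopologicalSpace O] [CompactSpace O]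
    (hcont : Continuous ((algebraMap K 𝕜).comp (algebraMap O K))) {a : ∀ n, (L n)ˣ}
    (ha : ∀ n, Units.map (Nm n) (a (n + 1)) = a n) :
    ∃ (k : ℤ) (g : PowerSeries O), IsUnit g ∧
      ∀ n, θ n ^ k * psEval ((algebraMap K 𝕜).comp (algebraMap O K)) (θ n) g = (a n : L n) := by
  set ι := (algebraMap K 𝕜).comp (algebraMap O K) with hι
  have h2 := H.two_lt
  have hθ0 (n : ℕ) : θ n ≠ 0 := IsTorsionSequence.ne_zero' H hθ n
  have hθpos (n : ℕ) : 0 < ‖θ n‖ := IsTorsionSequence.norm_pos H hθ n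
  let t (n : ℕ) : (L n)ˣ := Units.mk0 ⟨θ n, T.mem n⟩ fun h => hθ0 n (congrArg Subtype.val h)
  have ht (n : ℕ) : Units.map (Nm n) (t (n + 1)) = t n := Units.ext (T.norm_theta hθ H n)
  have ha0 (n : ℕ) : ((a n : L n) : 𝕜) ≠ 0 := by
    rw [Ne, ZeroMemClass.coe_eq_zero]
    exact (a n).ne_zero
  have hnorm (n : ℕ) : ‖((a (n + 1) : L (n + 1)) : 𝕜)‖ ^ f.natDegree = ‖((a n : L n) : 𝕜)‖ := by
    obtain ⟨p, hp, hpa⟩ := T.exists_aeval (n + 1) _ (a (n + 1) : L (n + 1)).2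
    have h3 := T.norm_eq n (a (n + 1)) p hpa.symm
    have h4 : (Nm n (a (n + 1)) : 𝕜) = (a n : L n) := by rw [← ha n]; rfl
    rw [← h4, h3, norm_prod, ← H.card_zeros, ← Finset.prod_const, ← hpa]
    refine Finset.prod_congr rfl fun u hu => ?_
    refine (H.norm_aeval_eq_of_norm_eq (IsTorsionSequence.norm_pow_eq H hθ (n + 1)) ?_ hp).symm
    have h5 : ‖u‖ < ‖θ (n + 1)‖ := by
      refine (IsTorsionSequence.norm_le_of_mem_zeros H hθ hu).trans_lt ?_
      refine (IsTorsionSequence.norm_zero_le H hθ n).trans_lt ?_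
      rw [← IsTorsionSequence.norm_succ_pow H hθ n]
      exact pow_lt_self_of_lt_one₀ (hθpos _) (IsTorsionSequence.norm_lt_one H hθ _) (by omega)
    rw [IsUltrametricDist.norm_add_eq_max_of_norm_ne_norm h5.ne', max_eq_left h5.le]
  obtain ⟨k, hk⟩ : ∃ k : ℤ, ‖((a 0 : L 0) : 𝕜)‖ = ‖θ 0‖ ^ k := by
    obtain ⟨p, hp, hpa⟩ := T.exists_aeval 0 _ (a 0 : L 0).2
    rw [← hpa]
    refine H.exists_norm_aeval_eq_zpow (IsTorsionSequence.norm_pow_eq H hθ 0) hp ?_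
    rintro rfl
    exact ha0 0 (by rw [← hpa, map_zero])
  have hk' (n : ℕ) : ‖((a n : L n) : 𝕜)‖ = ‖θ n‖ ^ k := by
    induction n with
    | zero => exact hk
    | succ n ih =>
      refine (pow_left_inj₀ (norm_nonneg _) (by positivity) (n := f.natDegree) (by omega)).mp ?_
      rw [hnorm, ih, ← zpow_natCast, zpow_comm, zpow_natCast, IsTorsionSequence.norm_succ_pow H hθ]
  let b : ∀ n, (L n)ˣ := fun n => a n * t n ^ (-k)
  have hbval (n : ℕ) : ((b n : L n) : 𝕜) = (a n : L n) * θ n ^ (-k) := by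
    have hsub : ((t n : L n) : 𝕜) = θ n := rfl
    simp only [b, Units.val_mul, MulMemClass.coe_mul, Units.val_zpow_eq_zpow_val]
    rw [← hsub]
    exact congrArg _ (map_zpow₀ (algebraMap (L n) 𝕜) _ _)
  obtain ⟨g, hg, hgb⟩ := T.exists_psEval_eq H hθ hcont (b := fun n => (b n : L n))
    (fun n => by
      have : Units.map (Nm n) (b (n + 1)) = b n := by
        rw [map_mul, map_zpow, ha, ht]
      exact congrArg Units.val this)
    (fun n => by
      rw [hbval, norm_mul, norm_zpow, hk', ← zpow_add₀ (hθpos n).ne', add_neg_cancel, zpow_zero])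
  refine ⟨k, g, hg, fun n => ?_⟩
  rw [hgb, hbval, mul_comm, mul_assoc, ← zpow_add₀ (hθ0 n), neg_add_cancel, zpow_zero, mul_one]

end IsNormTower

end Interpolation

/-! ### The tower generated by the torsion points -/

section FieldNorm

/-- The norm of `p(t)` is the product of the `p(s)` over the conjugates `s` of a separable
generator `t`, as soon as these lie in an extension `C` (which need not be algebraically closed). -/
theorem algebraMap_norm_aeval_eq_prod {L M C : Type*} [Field L] [Field M] [Field C] [Algebra L M]
    [Algebra L C] [Algebra M C] [IsScalarTower L M C] {t : M} {D : L[X]} (hD : D ≠ 0)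
    (hDt : aeval t D = 0) (hdeg : Module.finrank L M = D.natDegree)
    (htop : IntermediateField.adjoin L {t} = ⊤) {S : Finset C}
    (hS : D.map (algebraMap L C) = ∏ s ∈ S, (X - Polynomial.C s)) (p : L[X]) :
    algebraMap L C (Algebra.norm L (aeval t p)) = ∏ s ∈ S, aeval s p := by
  classical
  have hfin : FiniteDimensional L M := by
    refine FiniteDimensional.of_finrank_pos ?_
    rw [hdeg, Nat.pos_iff_ne_zero]
    intro h0
    rw [natDegree_eq_zero] at h0
    obtain ⟨c, rfl⟩ := h0
    rw [aeval_C, map_eq_zero] at hDt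
    exact hD (by rw [hDt, map_zero])
  have hDsep : D.Separable := by
    rw [← separable_map (algebraMap L C), hS, separable_prod_X_sub_C_iff']
    exact fun x _ y _ h => h
  have htsep : IsSeparable L t := hDsep.of_dvd (minpoly.dvd L t hDt)
  have hsep : Algebra.IsSeparable L M := by
    have h1 := (IntermediateField.isSeparable_adjoin_simple_iff_isSeparable L M).mpr htsep
    rw [htop] at h1
    exact AlgEquiv.Algebra.isSeparable IntermediateField.topEquiv
  let E := AlgebraicClosure C
  have hinj : Function.Injective (algebraMap C E) := (algebraMap C E).injective
  let S' : Finset E := S.map ⟨algebraMap C E, hinj⟩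
  have hσinj : Function.Injective fun σ : M →ₐ[L] E => σ t := by
    intro σ τ h
    ext x
    have hx : x ∈ IntermediateField.adjoin L {t} := htop ▸ IntermediateField.mem_top
    induction hx using IntermediateField.adjoin_induction with
    | mem x hx =>
      rw [Set.mem_singleton_iff] at hx
      subst hx
      exact h
    | algebraMap c => rw [AlgHom.commutes, AlgHom.commutes]
    | add x y _ _ hx hy => rw [map_add, map_add, hx, hy]
    | inv x _ hx => rw [map_inv₀, map_inv₀, hx]
    | mul x y _ _ hx hy => rw [map_mul, map_mul, hx, hy]
  have himage : Finset.univ.image (fun σ : M →ₐ[L] E => σ t) = S' := by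
    refine Finset.eq_of_subset_of_card_le ?_ ?_
    · intro x hx
      obtain ⟨σ, -, rfl⟩ := Finset.mem_image.mp hx
      have h1 : aeval (σ t) D = 0 := by rw [aeval_algHom_apply, hDt, map_zero]
      rw [aeval_def, IsScalarTower.algebraMap_eq L C E, ← eval₂_map, hS, eval₂_finsetProd,
        Finset.prod_eq_zero_iff] at h1
      obtain ⟨s, hs, h2⟩ := h1
      rw [eval₂_sub, eval₂_X, eval₂_C, sub_eq_zero] at h2
      exact Finset.mem_map.mpr ⟨s, hs, h2.symm⟩
    · rw [Finset.card_image_of_injective _ hσinj, Finset.card_univ, AlgHom.card, Finset.card_map,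
        hdeg, ← natDegree_map (algebraMap L C), hS, natDegree_prod_of_monic _ _ fun s _ =>
          monic_X_sub_C s]
      simp
  refine hinj ?_
  rw [← IsScalarTower.algebraMap_apply, Algebra.norm_eq_prod_embeddings L E, map_prod]
  have h3 : ∀ σ : M →ₐ[L] E, σ (aeval t p) = aeval (σ t) p := fun σ =>
    (aeval_algHom_apply σ t p).symm
  simp only [h3]
  rw [← Finset.prod_image (s := Finset.univ) (g := fun σ : M →ₐ[L] E => σ t)
    (f := fun x => aeval x p) (fun σ _ τ _ h => hσinj h), himage, Finset.prod_map]
  exact Finset.prod_congr rfl fun s _ => aeval_algebraMap_apply E s p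

/-- The norm map of an inclusion of intermediate fields. -/
def inclusionNorm {K C : Type*} [Field K] [Field C] [Algebra K C] {L M : IntermediateField K C}
    (h : L ≤ M) : M →* L :=
  letI : Algebra L M := (IntermediateField.inclusion h).toRingHom.toAlgebra
  Algebra.norm L

theorem coe_inclusionNorm_eq_prod {K C : Type*} [Field K] [Field C] [Algebra K C]
    {L M : IntermediateField K C} (h : L ≤ M) {t : C} (hM : M = IntermediateField.adjoin K {t})
    {D : L[X]} (hD : D ≠ 0) (hDt : aeval t D = 0) (hpos : 0 < Module.finrank K L)
    (hdeg : Module.finrank K M = Module.finrank K L * D.natDegree) {S : Finset C}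
    (hS : D.map (algebraMap L C) = ∏ s ∈ S, (X - Polynomial.C s)) (p : K[X]) (x : M)
    (hx : (x : C) = aeval t p) : (inclusionNorm h x : C) = ∏ s ∈ S, aeval s p := by
  let _ : Algebra L M := (IntermediateField.inclusion h).toRingHom.toAlgebra
  have : IsScalarTower K L M := IsScalarTower.of_algebraMap_eq fun _ => rfl
  have : IsScalarTower L M C := IsScalarTower.of_algebraMap_eq fun _ => rfl
  have htM : t ∈ M := by
    rw [hM]
    exact IntermediateField.mem_adjoin_simple_self K t
  have hx' : x = aeval (⟨t, htM⟩ : M) (p.map (algebraMap K L)) := by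
    refine Subtype.ext ?_
    rw [hx, aeval_map_algebraMap]
    exact aeval_algebraMap_apply C (⟨t, htM⟩ : M) p
  have hDt' : aeval (⟨t, htM⟩ : M) D = 0 := by
    refine (algebraMap M C).injective ?_
    rw [← aeval_algebraMap_apply, map_zero]
    exact hDt
  have hdeg' : Module.finrank L M = D.natDegree := by
    refine Nat.eq_of_mul_eq_mul_left hpos ?_
    rw [Module.finrank_mul_finrank, hdeg]
  have htop : IntermediateField.adjoin L {(⟨t, htM⟩ : M)} = ⊤ := by
    refine IntermediateField.restrictScalars_injective K ?_
    rw [IntermediateField.restrictScalars_top, eq_top_iff]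
    have h1 : IntermediateField.adjoin K {(⟨t, htM⟩ : M)} = ⊤ := by
      refine IntermediateField.map_injective M.val ?_
      rw [IntermediateField.adjoin_map, ← AlgHom.fieldRange_eq_map, IntermediateField.fieldRange_val,
        Set.image_singleton]
      exact hM.symm
    rw [← h1, IntermediateField.adjoin_simple_le_iff]
    exact IntermediateField.mem_adjoin_simple_self L (⟨t, htM⟩ : M)
  have := algebraMap_norm_aeval_eq_prod hD hDt' hdeg' htop hS (p.map (algebraMap K L))
  rw [← hx'] at this
  refine Eq.trans this (Finset.prod_congr rfl fun s _ => ?_)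
  rw [aeval_map_algebraMap]

end FieldNorm

section Tower

variable {O K 𝕜 : Type*} [CommRing O] [Field K] [Algebra O K] [IsFractionRing O K] [NormedField 𝕜]
  [Algebra K 𝕜] [IsUltrametricDist 𝕜] {ϖ : O} {f : O[X]}
  (H : IsFrobeniusType ((algebraMap K 𝕜).comp (algebraMap O K)) ϖ f)
  {θ : ℕ → 𝕜} (hθ : IsTorsionSequence ((algebraMap K 𝕜).comp (algebraMap O K)) f θ)

include H hθ

omit [IsFractionRing O K] [IsUltrametricDist 𝕜] in
/-- `θₙ` is a zero of the monic polynomial `f^(n+1) / f^n`. -/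
theorem exists_monic_aeval_eq_zero (n : ℕ) : ∃ D : K[X], D.Monic ∧
    D.natDegree = (f.natDegree - 1) * f.natDegree ^ n ∧ aeval (θ n) D = 0 := by
  have : Nontrivial O := ⟨ϖ, 0, H.ne_zero⟩
  have h2 := H.two_lt
  obtain ⟨h3, h4, -⟩ := H.iterate_comp n
  have hX : f = f.divX * X := by
    conv_lhs => rw [← divX_mul_X_add f, H.coeff_zero, map_zero, add_zero]
  have hdeg : f.divX.natDegree = f.natDegree - 1 := natDegree_divX_eq_natDegree_tsub_one
  have hmonic : f.divX.Monic := by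
    refine monic_X.of_mul_monic_right ?_
    rw [← hX]
    exact H.monic
  have hD : (f.divX.comp (f.comp^[n] X)).Monic := by
    refine hmonic.comp h3 ?_
    rw [h4]
    positivity
  refine ⟨(f.divX.comp (f.comp^[n] X)).map (algebraMap O K), hD.map _, ?_, ?_⟩
  · rw [hD.natDegree_map, natDegree_comp_eq_of_mul_ne_zero, h4, hdeg]
    rw [hmonic.leadingCoeff, h3.leadingCoeff, one_pow, one_mul]
    exact one_ne_zero
  · rw [← eval₂_eq_aeval_map, eval₂_comp, eval₂_iterate_comp]
    have h (n : ℕ) : (fun x => f.eval₂ ((algebraMap K 𝕜).comp (algebraMap O K)) x)^[n] (θ n)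
        = θ 0 := by
      induction n with
      | zero => rfl
      | succ n ih => rw [Function.iterate_succ_apply, hθ.eval_succ, ih]
    have h5 := hθ.eval_zero
    rw [h]
    conv_lhs at h5 => rw [hX]
    rw [eval₂_mul, eval₂_X] at h5
    exact (mul_eq_zero.mp h5).resolve_right hθ.ne_zero

omit [IsFractionRing O K] [IsUltrametricDist 𝕜] in
theorem isIntegral_theta (n : ℕ) : IsIntegral K (θ n) := by
  obtain ⟨D, hD, -, h0⟩ := exists_monic_aeval_eq_zero H hθ n
  exact ⟨D, hD, h0⟩

/-- `K(θₙ) / K` is totally ramified of degree `(Q - 1) Q ^ n`. -/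
theorem natDegree_minpoly_theta (n : ℕ) :
    (minpoly K (θ n)).natDegree = (f.natDegree - 1) * f.natDegree ^ n := by
  obtain ⟨D, hD, hdeg, h0⟩ := exists_monic_aeval_eq_zero H hθ n
  refine le_antisymm ?_ ?_
  · rw [← hdeg]
    exact natDegree_le_of_dvd (minpoly.dvd K _ h0) hD.ne_zero
  · by_contra! hlt
    exact minpoly.ne_zero (isIntegral_theta H hθ n) (H.eq_zero_of_aeval_eq_zero
      (IsTorsionSequence.norm_pow_eq H hθ n) hlt (minpoly.aeval K (θ n)))

theorem isNormTower {L : ℕ → IntermediateField K 𝕜}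
    (hL : ∀ n, L n = IntermediateField.adjoin K {θ n}) (hle : ∀ n, L n ≤ L (n + 1)) :
    IsNormTower (O := O) f θ L fun n => inclusionNorm (hle n) := by
  have h2 := H.two_lt
  have hmem (n : ℕ) : θ n ∈ L n := by
    rw [hL]
    exact IntermediateField.mem_adjoin_simple_self K _
  have hfinrank (n : ℕ) : Module.finrank K (L n) = (f.natDegree - 1) * f.natDegree ^ n := by
    rw [hL, IntermediateField.adjoin.finrank (isIntegral_theta H hθ n),
      natDegree_minpoly_theta H hθ]
  refine ⟨hmem, fun n x hx => ?_, fun n x p hx => ?_⟩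
  · have hint := isIntegral_theta H hθ n
    rw [hL] at hx
    obtain ⟨p, hpx⟩ := (IntermediateField.adjoin.powerBasis hint).exists_eq_aeval' ⟨x, hx⟩
    refine ⟨p %ₘ minpoly K (θ n), ?_, ?_⟩
    · rw [← natDegree_minpoly_theta H hθ n]
      refine natDegree_modByMonic_lt p (minpoly.monic hint) fun h1 => ?_
      have h3 := natDegree_minpoly_theta H hθ n
      rw [h1, natDegree_one] at h3
      have : 0 < f.natDegree - 1 := by omega
      have : 0 < (f.natDegree - 1) * f.natDegree ^ n := by positivity
      omega
    · rw [aeval_modByMonic_eq_self_of_root (minpoly.aeval K _)]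
      have h4 := congrArg Subtype.val hpx
      rw [IntermediateField.adjoin.powerBasis_gen] at h4
      refine Eq.trans ?_ h4.symm
      exact aeval_algebraMap_apply 𝕜 (IntermediateField.AdjoinSimple.gen K (θ n)) p
  · have hmap : (f.map ((algebraMap K (L n)).comp (algebraMap O K)) -
        Polynomial.C (⟨θ n, hmem n⟩ : L n)).map (algebraMap (L n) 𝕜) =
        ∏ s ∈ (zeros ((algebraMap K 𝕜).comp (algebraMap O K)) f).map
          (addLeftEmbedding (θ (n + 1))), (X - Polynomial.C s) := by
      rw [← H.map_sub_C_eq_prod, hθ.eval_succ, Polynomial.map_sub, Polynomial.map_map, map_C]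
      rfl
    have hdeg : (f.map ((algebraMap K (L n)).comp (algebraMap O K)) -
        Polynomial.C (⟨θ n, hmem n⟩ : L n)).natDegree = f.natDegree := by
      rw [natDegree_sub_C, H.monic.natDegree_map]
    have := coe_inclusionNorm_eq_prod (hle n) (hL (n + 1)) (t := θ (n + 1)) ?_ ?_ ?_ ?_ hmap p x hx
    · rw [this, Finset.prod_map]
      rfl
    · intro h0
      rw [h0, natDegree_zero] at hdeg
      omega
    · rw [aeval_def, ← eval_map, hmap, eval_prod]
      refine Finset.prod_eq_zero (i := θ (n + 1)) (Finset.mem_map.mpr ⟨0, H.zero_mem_zeros, ?_⟩) ?_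
      · exact add_zero _
      · simp
    · rw [hfinrank]
      have : 0 < f.natDegree - 1 := by omega
      positivity
    · rw [hfinrank, hfinrank, hdeg, pow_succ, mul_assoc]

end Tower

/-! ### Evaluation of Laurent series -/

section LaurentEval

variable {R 𝕜 : Type*} [CommRing R] [NormedField 𝕜]

/-- The value `∑ κ(hᵢ) zⁱ` of a Laurent series at a point of a normed field. -/
def lsEval (κ : R →+* 𝕜) (z : 𝕜) (h : R⸨X⸩) : 𝕜 := ∑' i : ℤ, κ (h.coeff i) * z ^ i

/-- The Laurent series `x ^ k * g(x)`. -/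
def shift (k : ℤ) (g : PowerSeries R) : R⸨X⸩ :=
  HahnSeries.single k 1 * HahnSeries.ofPowerSeries ℤ R g

theorem exists_eq_shift (h : R⸨X⸩) : ∃ k g, h = shift k g :=
  ⟨_, _, h.single_order_mul_powerSeriesPart.symm⟩

theorem shift_mul_shift (k l : ℤ) (g h : PowerSeries R) :
    shift k g * shift l h = shift (k + l) (g * h) := by
  rw [shift, shift, shift, map_mul, ← one_mul (1 : R), ← HahnSeries.single_mul_single, one_mul]
  ring

theorem shift_one : shift 0 (1 : PowerSeries R) = 1 := by
  change 1 * HahnSeries.ofPowerSeries ℤ R 1 = 1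
  rw [map_one, one_mul]

/-- The unit `x ^ k * g(x)` of the ring of Laurent series, for an invertible power series `g`. -/
def shiftUnit (k : ℤ) (g : (PowerSeries R)ˣ) : (R⸨X⸩)ˣ where
  val := shift k g
  inv := shift (-k) ↑g⁻¹
  val_inv := by rw [shift_mul_shift, add_neg_cancel, Units.mul_inv, shift_one]
  inv_val := by rw [shift_mul_shift, neg_add_cancel, Units.inv_mul, shift_one]

theorem exists_eq_shiftUnit [IsDomain R] (h : (R⸨X⸩)ˣ) :
    ∃ k g, h = shiftUnit k g := by
  have h1 : h.val.leadingCoeff * h⁻¹.val.leadingCoeff = 1 := by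
    rw [← HahnSeries.leadingCoeff_mul, Units.mul_inv, HahnSeries.leadingCoeff_one]
  have h2 : IsUnit h.val.powerSeriesPart := by
    rw [PowerSeries.isUnit_iff_constantCoeff, ← PowerSeries.coeff_zero_eq_constantCoeff_apply,
      LaurentSeries.powerSeriesPart_coeff, Nat.cast_zero, add_zero, ← HahnSeries.leadingCoeff_eq]
    exact IsUnit.of_mul_eq_one _ h1
  refine ⟨h.val.order, h2.unit, Units.ext ?_⟩
  exact h.val.single_order_mul_powerSeriesPart.symm

theorem hasSum_shift {κ : R →+* 𝕜} {z : 𝕜} (hz0 : z ≠ 0) {g : PowerSeries R}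
    (hg : Summable fun n : ℕ => κ (PowerSeries.coeff n g) * z ^ n) (k : ℤ) :
    HasSum (fun i : ℤ => κ ((shift k g).coeff i) * z ^ i) (z ^ k * psEval κ z g) := by
  have hinj : Function.Injective fun n : ℕ => (n : ℤ) + k := fun m n h => by simpa using h
  rw [← hinj.hasSum_iff]
  · refine (hg.hasSum.mul_left (z ^ k)).congr_fun fun n => ?_
    simp only [Function.comp_apply, shift, HahnSeries.coeff_single_mul_add,
      LaurentSeries.coeff_coe_powerSeries, one_mul, zpow_add₀ hz0, zpow_natCast]
    ring
  · intro i hi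
    have hik : i - k < 0 := by
      by_contra! h
      refine hi ⟨(i - k).toNat, ?_⟩
      simp only
      omega
    rw [shift, HahnSeries.coeff_single_mul, PowerSeries.coeff_coe, if_pos hik, mul_zero, map_zero,
      zero_mul]

section Integral

variable {κ : R →+* 𝕜} (hκ : ∀ a, ‖κ a‖ ≤ 1) {z : 𝕜} (hz0 : z ≠ 0) (hz : ‖z‖ < 1)
  [CompleteSpace 𝕜]
include hκ hz0 hz

theorem summable_lsEval (h : R⸨X⸩) : Summable fun i : ℤ => κ (h.coeff i) * z ^ i := by
  obtain ⟨k, g, rfl⟩ := exists_eq_shift h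
  exact (hasSum_shift hz0 (summable_psEval hκ hz g) k).summable

theorem lsEval_shift (k : ℤ) (g : PowerSeries R) :
    lsEval κ z (shift k g) = z ^ k * psEval κ z g :=
  (hasSum_shift hz0 (summable_psEval hκ hz g) k).tsum_eq

theorem lsEval_mul (g h : R⸨X⸩) : lsEval κ z (g * h) = lsEval κ z g * lsEval κ z h := by
  obtain ⟨k, g, rfl⟩ := exists_eq_shift g
  obtain ⟨l, h, rfl⟩ := exists_eq_shift h
  rw [shift_mul_shift, lsEval_shift hκ hz0 hz, lsEval_shift hκ hz0 hz, lsEval_shift hκ hz0 hz,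
    psEval_mul hκ hz, zpow_add₀ hz0]
  ring

theorem lsEval_one : lsEval κ z 1 = 1 := by
  rw [← shift_one, lsEval_shift hκ hz0 hz, psEval_one hκ hz, zpow_zero, one_mul]

theorem lsEval_sub (g h : R⸨X⸩) : lsEval κ z (g - h) = lsEval κ z g - lsEval κ z h := by
  rw [lsEval, lsEval, lsEval,
    ← (summable_lsEval hκ hz0 hz g).tsum_sub (summable_lsEval hκ hz0 hz h)]
  simp only [HahnSeries.coeff_sub, map_sub, sub_mul]

theorem lsEval_units_ne_zero (h : (R⸨X⸩)ˣ) : lsEval κ z h.val ≠ 0 := by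
  refine left_ne_zero_of_mul_eq_one (b := lsEval κ z h⁻¹.val) ?_
  rw [← lsEval_mul hκ hz0 hz, Units.mul_inv, lsEval_one hκ hz0 hz]

end Integral

/-- The zeros of a nonzero Laurent series that converges near `0` do not accumulate at `0`. -/
theorem eq_zero_of_lsEval_eq_zero [IsUltrametricDist 𝕜] {κ : R →+* 𝕜}
    (hκ : Function.Injective κ) {h : R⸨X⸩} {w : 𝕜} (hw0 : w ≠ 0)
    (hw : Summable fun i : ℤ => κ (h.coeff i) * w ^ i) {s : ℕ → 𝕜} (hs0 : ∀ n, s n ≠ 0)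
    (hs : Filter.Tendsto s Filter.atTop (nhds 0))
    (hsum : ∀ n, Summable fun i : ℤ => κ (h.coeff i) * s n ^ i)
    (hzero : ∀ n, lsEval κ (s n) h = 0) : h = 0 := by
  by_contra h0
  obtain ⟨M, hM⟩ : ∃ M, ∀ i : ℤ, ‖κ (h.coeff i) * w ^ i‖ ≤ M := by
    have := hw.tendsto_cofinite_zero.norm
    obtain ⟨M, hM⟩ := this.bddAbove_range_of_cofinite
    exact ⟨M, fun i => hM ⟨i, rfl⟩⟩
  set k := h.order with hk
  have hlead : 0 < ‖κ (h.coeff k)‖ := by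
    rw [norm_pos_iff, map_ne_zero_iff κ hκ, hk, ← HahnSeries.leadingCoeff_eq,
      Ne, HahnSeries.leadingCoeff_eq_zero]
    exact h0
  have hwpos : 0 < ‖w‖ := norm_pos_iff.mpr hw0
  have hM0 : 0 ≤ M := (norm_nonneg _).trans (hM 0)
  -- Near `0` the term of lowest degree dominates.
  have hev : ∀ᶠ n in Filter.atTop, ‖s n‖ < ‖w‖ ∧
      M * ‖s n‖ < ‖κ (h.coeff k)‖ * ‖w‖ ^ (k + 1) := by
    have h1 : Filter.Tendsto (fun n => ‖s n‖) Filter.atTop (nhds 0) := by simpa using hs.norm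
    have h2 : Filter.Tendsto (fun n => M * ‖s n‖) Filter.atTop (nhds 0) := by
      simpa using h1.const_mul M
    exact (h1.eventually (gt_mem_nhds hwpos)).and (h2.eventually (gt_mem_nhds (by positivity)))
  obtain ⟨n, hn1, hn2⟩ := hev.exists
  set x := s n
  have hxpos : 0 < ‖x‖ := norm_pos_iff.mpr (hs0 n)
  have hval := hzero n
  rw [lsEval, (hsum n).tsum_eq_add_tsum_ite k] at hval
  have hrest : ‖∑' i : ℤ, ite (i = k) 0 (κ (h.coeff i) * x ^ i)‖ ≤
      M * (‖x‖ / ‖w‖) ^ (k + 1) := by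
    refine IsUltrametricDist.norm_tsum_le_of_forall_le_of_nonneg (by positivity) fun i => ?_
    rcases lt_trichotomy i k with hi | rfl | hi
    · rw [if_neg hi.ne, HahnSeries.coeff_eq_zero_of_lt_order hi]
      simp only [map_zero, zero_mul, norm_zero]
      positivity
    · simp only [if_true, norm_zero]
      positivity
    · rw [if_neg hi.ne']
      have h1 : κ (h.coeff i) * x ^ i = κ (h.coeff i) * w ^ i * (x / w) ^ i := by
        rw [div_zpow, mul_assoc, mul_div_cancel₀ _ (zpow_ne_zero i hw0)]
      rw [h1, norm_mul, norm_zpow, norm_div]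
      refine mul_le_mul (hM i) ?_ (by positivity) hM0
      exact zpow_le_zpow_right_of_le_one₀ (by positivity) ((div_le_one hwpos).mpr hn1.le) hi
  have heq : ‖κ (h.coeff k)‖ * ‖x‖ ^ k ≤ M * (‖x‖ / ‖w‖) ^ (k + 1) := by
    rw [← norm_zpow, ← norm_mul, eq_neg_of_add_eq_zero_left hval, norm_neg]
    exact hrest
  rw [div_zpow, ← mul_div_assoc, le_div_iff₀ (by positivity), zpow_add_one₀ hxpos.ne' k] at heq
  have hxk : 0 < ‖x‖ ^ k := by positivity
  nlinarith

end LaurentEval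

/-! ### The norm operator on units and the evaluation isomorphism -/

section Main

variable {O K 𝕜 : Type*} [CommRing O] [Field K] [Algebra O K] [NormedField 𝕜]
  [Algebra K 𝕜] {ϖ : O} {f : O[X]} [CompleteSpace 𝕜] [IsUltrametricDist 𝕜]

section Norm

variable {ι : O →+* 𝕜} (H : IsFrobeniusType ι ϖ f) {θ : ℕ → 𝕜} (hθ : IsTorsionSequence ι f θ)

include H hθ

theorem IsTorsionSequence.eq_of_lsEval_eq {g h : O⸨X⸩}
    (heq : ∀ n, lsEval ι (θ n) g = lsEval ι (θ n) h) : g = h := by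
  rw [← sub_eq_zero]
  have h1 (n : ℕ) : lsEval ι (θ n) (g - h) = 0 := by
    rw [lsEval_sub H.norm_le_one (hθ.ne_zero' H n) (hθ.norm_lt_one H n), heq, sub_self]
  obtain ⟨k, p, hp⟩ := exists_eq_shift (g - h)
  have h2 : p = 0 := by
    refine hθ.eq_of_psEval_eq H fun n => ?_
    have h3 := h1 n
    rw [hp, lsEval_shift H.norm_le_one (hθ.ne_zero' H n) (hθ.norm_lt_one H n)] at h3
    rw [psEval_zero H.norm_le_one (hθ.norm_lt_one H n)]
    exact (mul_eq_zero.mp h3).resolve_left (zpow_ne_zero k (hθ.ne_zero' H n))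
  rw [hp, h2, shift, map_zero, mul_zero]

variable [IsAdicComplete (Ideal.span {ϖ}) O]

theorem lsEval_shift_psNorm (k : ℤ) (g : PowerSeries O) {z : 𝕜} (hz : ‖z‖ < 1)
    (hfz : f.eval₂ ι z ≠ 0) :
    lsEval ι (f.eval₂ ι z) (shift k (psNorm H hθ g)) =
      ∏ u ∈ zeros ι f, lsEval ι (z + u) (shift k g) := by
  rw [lsEval_shift H.norm_le_one hfz (H.norm_eval_lt_one hz), psEval_psNorm H hθ g hz,
    ← H.prod_add_zeros, ← Finset.prod_zpow, ← Finset.prod_mul_distrib]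
  refine Finset.prod_congr rfl fun u hu => ?_
  rw [lsEval_shift H.norm_le_one ?_ (H.norm_add_zeros_lt_one hz hu)]
  intro h0
  rw [← H.prod_add_zeros] at hfz
  exact Finset.prod_ne_zero_iff.mp hfz u hu h0

theorem exists_lsNorm (g : (O⸨X⸩)ˣ) : ∃ h : (O⸨X⸩)ˣ, ∀ z : 𝕜, ‖z‖ < 1 → f.eval₂ ι z ≠ 0 →
    lsEval ι (f.eval₂ ι z) h.val = ∏ u ∈ zeros ι f, lsEval ι (z + u) g.val := by
  have : IsDomain O := H.injective.isDomain ι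
  obtain ⟨k, g, rfl⟩ := exists_eq_shiftUnit g
  exact ⟨shiftUnit k (Units.map (psNorm H hθ) g), fun z hz hfz =>
    lsEval_shift_psNorm H hθ k g hz hfz⟩

/-- The norm operator `𝒩` on the unit group of the ring of Laurent series. -/
def lsNorm : (O⸨X⸩)ˣ →* (O⸨X⸩)ˣ :=
  MonoidHom.mk' (fun g => (exists_lsNorm H hθ g).choose) fun g h => by
    refine Units.ext (hθ.eq_of_lsEval_eq H fun n => ?_)
    have hz := hθ.norm_lt_one H (n + 1)
    have hfz : f.eval₂ ι (θ (n + 1)) ≠ 0 := by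
      rw [hθ.eval_succ]
      exact hθ.ne_zero' H n
    rw [← hθ.eval_succ n, (exists_lsNorm H hθ (g * h)).choose_spec _ hz hfz, Units.val_mul,
      Units.val_mul, lsEval_mul H.norm_le_one hfz (H.norm_eval_lt_one hz),
      (exists_lsNorm H hθ g).choose_spec _ hz hfz, (exists_lsNorm H hθ h).choose_spec _ hz hfz,
      ← Finset.prod_mul_distrib]
    refine Finset.prod_congr rfl fun u hu => ?_
    rw [lsEval_mul H.norm_le_one ?_ (H.norm_add_zeros_lt_one hz hu)]
    intro h0
    rw [← H.prod_add_zeros] at hfz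
    exact Finset.prod_ne_zero_iff.mp hfz u hu h0

theorem lsEval_lsNorm (g : (O⸨X⸩)ˣ) {z : 𝕜} (hz : ‖z‖ < 1) (hfz : f.eval₂ ι z ≠ 0) :
    lsEval ι (f.eval₂ ι z) (lsNorm H hθ g).val = ∏ u ∈ zeros ι f, lsEval ι (z + u) g.val :=
  (exists_lsNorm H hθ g).choose_spec z hz hfz

theorem lsNorm_shiftUnit (k : ℤ) (g : (PowerSeries O)ˣ) :
    lsNorm H hθ (shiftUnit k g) = shiftUnit k (Units.map (psNorm H hθ) g) := by
  refine Units.ext (hθ.eq_of_lsEval_eq H fun n => ?_)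
  have hz := hθ.norm_lt_one H (n + 1)
  have hfz : f.eval₂ ι (θ (n + 1)) ≠ 0 := by
    rw [hθ.eval_succ]
    exact hθ.ne_zero' H n
  rw [← hθ.eval_succ n, lsEval_lsNorm H hθ _ hz hfz]
  exact (lsEval_shift_psNorm H hθ k g hz hfz).symm

end Norm

variable (H : IsFrobeniusType ((algebraMap K 𝕜).comp (algebraMap O K)) ϖ f)
  {θ : ℕ → 𝕜} (hθ : IsTorsionSequence ((algebraMap K 𝕜).comp (algebraMap O K)) f θ)
  {L : ℕ → IntermediateField K 𝕜} {Nm : ∀ n, L (n + 1) →* L n} [IsAdicComplete (Ideal.span {ϖ}) O]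
  (T : IsNormTower (O := O) f θ L Nm)

include H hθ T in
theorem lsEval_mem (g : (O⸨X⸩)ˣ) (n : ℕ) :
    lsEval ((algebraMap K 𝕜).comp (algebraMap O K)) (θ n) g.val ∈ L n := by
  have : IsDomain O := H.injective.isDomain _
  obtain ⟨k, g, rfl⟩ := exists_eq_shiftUnit g
  change lsEval _ _ (shift k g.val) ∈ _
  rw [lsEval_shift H.norm_le_one (hθ.ne_zero' H n) (hθ.norm_lt_one H n)]
  exact mul_mem (zpow_mem (T.mem n) k) (T.psEval_mem H hθ n g)

/-- Evaluation at the torsion points. -/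
def evalUnits : (O⸨X⸩)ˣ →* ∀ n, (L n)ˣ where
  toFun g n := Units.mk0 ⟨_, lsEval_mem H hθ T g n⟩ fun h =>
    lsEval_units_ne_zero H.norm_le_one (hθ.ne_zero' H n) (hθ.norm_lt_one H n) g
      (congrArg Subtype.val h)
  map_one' := by
    ext n
    exact lsEval_one H.norm_le_one (hθ.ne_zero' H n) (hθ.norm_lt_one H n)
  map_mul' g h := by
    ext n
    exact lsEval_mul H.norm_le_one (hθ.ne_zero' H n) (hθ.norm_lt_one H n) g.val h.val

theorem coe_evalUnits (g : (O⸨X⸩)ˣ) (n : ℕ) : ((evalUnits H hθ T g n : L n) : 𝕜) =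
    lsEval ((algebraMap K 𝕜).comp (algebraMap O K)) (θ n) g.val := rfl

theorem map_evalUnits_succ (g : (O⸨X⸩)ˣ) (n : ℕ) :
    Units.map (Nm n) (evalUnits H hθ T g (n + 1)) = evalUnits H hθ T (lsNorm H hθ g) n := by
  have : IsDomain O := H.injective.isDomain _
  obtain ⟨k, g, rfl⟩ := exists_eq_shiftUnit g
  have hθ0 (n : ℕ) := hθ.ne_zero' H n
  have hθ1 (n : ℕ) := hθ.norm_lt_one H n
  set ι := (algebraMap K 𝕜).comp (algebraMap O K)
  let x : L (n + 1) := ⟨psEval ι (θ (n + 1)) g, T.psEval_mem H hθ (n + 1) g⟩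
  have hx := T.psEval_psNorm_eq H hθ n g x rfl
  have hx0 : x ≠ 0 := by
    intro h0
    have h1 : psEval ι (θ (n + 1)) (g : PowerSeries O) = 0 := congrArg Subtype.val h0
    have h2 := psEval_mul H.norm_le_one (hθ1 (n + 1)) (g : PowerSeries O) ↑g⁻¹
    rw [Units.mul_inv, psEval_one H.norm_le_one (hθ1 (n + 1)), h1, zero_mul] at h2
    exact one_ne_zero h2
  let t (n : ℕ) : (L n)ˣ := Units.mk0 ⟨θ n, T.mem n⟩ fun h => hθ0 n (congrArg Subtype.val h)
  have ht : Units.map (Nm n) (t (n + 1)) = t n := Units.ext (T.norm_theta hθ H n)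
  have htval (n : ℕ) : (((t n ^ k : (L n)ˣ) : L n) : 𝕜) = θ n ^ k := by
    rw [Units.val_zpow_eq_zpow_val]
    exact map_zpow₀ (algebraMap (L n) 𝕜) _ _
  have h1 : evalUnits H hθ T (shiftUnit k g) (n + 1) = t (n + 1) ^ k * Units.mk0 x hx0 := by
    refine Units.ext (Subtype.ext ?_)
    rw [coe_evalUnits, Units.val_mul, MulMemClass.coe_mul, htval]
    exact lsEval_shift H.norm_le_one (hθ0 _) (hθ1 _) k g
  rw [h1, map_mul, map_zpow, ht, lsNorm_shiftUnit]
  refine Units.ext (Subtype.ext ?_)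
  rw [coe_evalUnits, Units.val_mul, MulMemClass.coe_mul, htval]
  refine Eq.trans ?_ (lsEval_shift H.norm_le_one (hθ0 n) (hθ1 n) k (psNorm H hθ g)).symm
  rw [hx]
  rfl

include T in
/-- Coleman's theorem: evaluation at the torsion points identifies the units fixed by the norm
operator with the norm-compatible sequences of the tower. -/
theorem exists_evalUnits_mulEquiv [IsFractionRing O K] [TopologicalSpace O] [CompactSpace O]
    (hcont : Continuous ((algebraMap K 𝕜).comp (algebraMap O K)))
    (P : Subgroup (∀ n, (L n)ˣ)) (hP : ∀ a, a ∈ P ↔ ∀ n, Units.map (Nm n) (a (n + 1)) = a n) :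
    ∃ ev : (lsNorm H hθ).eqLocus (MonoidHom.id _) ≃* P, ∀ g n, (((ev g).val n : L n) : 𝕜) =
      lsEval ((algebraMap K 𝕜).comp (algebraMap O K)) (θ n) g.val.val := by
  have hmem (g : (O⸨X⸩)ˣ) : evalUnits H hθ T g ∈ P ↔ lsNorm H hθ g = g := by
    rw [hP]
    simp only [map_evalUnits_succ]
    refine ⟨fun h => Units.ext (hθ.eq_of_lsEval_eq H fun n => ?_), fun h n => by rw [h]⟩
    rw [← coe_evalUnits H hθ T, ← coe_evalUnits H hθ T, h]
  let φ : (lsNorm H hθ).eqLocus (MonoidHom.id _) →* P :=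
    ((evalUnits H hθ T).comp (Subgroup.subtype _)).codRestrict P fun g => (hmem g.val).mpr g.2
  have hφ (g : (lsNorm H hθ).eqLocus (MonoidHom.id _)) (n : ℕ) : (((φ g).val n : L n) : 𝕜) =
      lsEval ((algebraMap K 𝕜).comp (algebraMap O K)) (θ n) g.val.val := rfl
  have hbij : Function.Bijective φ := by
    refine ⟨fun g h hgh => ?_, fun a => ?_⟩
    · refine Subtype.ext (Units.ext (hθ.eq_of_lsEval_eq H fun n => ?_))
      rw [← hφ, ← hφ, hgh]
    · obtain ⟨k, g, hg, hga⟩ := T.exists_zpow_mul_psEval_eq H hθ hcont ((hP _).mp a.2)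
      have h1 : evalUnits H hθ T (shiftUnit k hg.unit) = a.val := by
        funext n
        refine Units.ext (Subtype.ext ?_)
        rw [coe_evalUnits, ← hga n]
        exact lsEval_shift H.norm_le_one (hθ.ne_zero' H n) (hθ.norm_lt_one H n) k g
      exact ⟨⟨shiftUnit k hg.unit, (hmem _).mp (h1 ▸ a.2)⟩, Subtype.ext h1⟩
  exact ⟨MulEquiv.ofBijective φ hbij, hφ⟩

end Main

/-! ### Completeness of the ring of integers -/

/-- Compactness of the ring of integers gives its adic completeness. -/
theorem IsFrobeniusType.isAdicComplete {O 𝕜 : Type*} [CommRing O] [NormedField 𝕜] {ι : O →+* 𝕜}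
    {ϖ : O} {f : O[X]} (H : IsFrobeniusType ι ϖ f) [IsUltrametricDist 𝕜] [TopologicalSpace O]
    [CompactSpace O] (hcont : Continuous ι) : IsAdicComplete (Ideal.span {ϖ}) O where
  haus' x hx := by
    by_contra h0
    obtain ⟨n, hn⟩ := H.exists_not_pow_dvd h0
    have := hx n
    rw [SModEq.zero, smul_eq_mul, Ideal.mul_top, Ideal.span_singleton_pow,
      Ideal.mem_span_singleton] at this
    exact hn this
  prec' s hs := by
    let S (n : ℕ) : Set O := {x | ‖ι (s n) - ι x‖ ≤ ‖ι ϖ‖ ^ n}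
    have hmem (n : ℕ) (x y : O) :
        x ≡ y [SMOD (Ideal.span {ϖ} ^ n • ⊤ : Ideal O)] ↔ ‖ι x - ι y‖ ≤ ‖ι ϖ‖ ^ n := by
      rw [SModEq.sub_mem, smul_eq_mul, Ideal.mul_top, Ideal.span_singleton_pow,
        Ideal.mem_span_singleton, ← H.norm_le_pow_iff, map_sub]
    have hS (n : ℕ) : S (n + 1) ⊆ S n := by
      intro x hx
      have h1 := (hmem n _ _).mp (hs n.le_succ)
      have h2 : ι (s n) - ι x = (ι (s n) - ι (s n.succ)) + (ι (s (n + 1)) - ι x) := by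
        rw [Nat.succ_eq_add_one]
        ring
      refine (congrArg norm h2).le.trans ((IsUltrametricDist.norm_add_le_max _ _).trans
        (max_le h1 (le_trans hx ?_)))
      exact pow_le_pow_of_le_one (norm_nonneg _) H.norm_lt_one.le n.le_succ
    have hclosed (n : ℕ) : IsClosed (S n) :=
      isClosed_le (by fun_prop) continuous_const
    obtain ⟨x, hx⟩ := (hclosed 0).isCompact.nonempty_iInter_of_sequence_nonempty_isCompact_isClosed
      S hS (fun n => ⟨s n, by simp [S]⟩) hclosed
    exact ⟨x, fun n => (hmem n _ _).mpr (Set.mem_iInter.mp hx n)⟩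

section Local

variable {F : Type*} [Field F] (𝔭 : HeightOneSpectrum F[X])

/-! ### The completed algebraic closure -/

instance : IsUltrametricDist (AlgCl 𝔭) :=
  IsUltrametricDist.isUltrametricDist_of_isNonarchimedean_norm
    (isNonarchimedean_spectralNorm (K := LocalField 𝔭) (L := AlgCl 𝔭))

instance : IsUltrametricDist (Cp 𝔭) :=
  IsUltrametricDist.isUltrametricDist_of_forall_norm_add_le_max_norm fun x y => by
    induction x, y using UniformSpace.Completion.induction_on₂ with
    | hp => exact isClosed_le (by fun_prop) (by fun_prop)
    | ih x y =>
      rw [← UniformSpace.Completion.coe_add, UniformSpace.Completion.norm_coe,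
        UniformSpace.Completion.norm_coe, UniformSpace.Completion.norm_coe]
      exact IsUltrametricDist.norm_add_le_max x y

theorem norm_algebraMap_Cp (x : LocalField 𝔭) : ‖algebraMap (LocalField 𝔭) (Cp 𝔭) x‖ = ‖x‖ :=
  norm_algebraMap' _ _

theorem norm_integersToCp (a : Integers 𝔭) : ‖integersToCp 𝔭 a‖ = ‖(a : LocalField 𝔭)‖ :=
  norm_algebraMap_Cp 𝔭 a

theorem norm_integersToCp_le_one (a : Integers 𝔭) : ‖integersToCp 𝔭 a‖ ≤ 1 := by
  rw [norm_integersToCp]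
  exact Valued.toNormedField.norm_le_one_iff.mpr a.2

theorem integersToCp_injective : Function.Injective (integersToCp 𝔭) :=
  (algebraMap (LocalField 𝔭) (Cp 𝔭)).injective.comp (IsFractionRing.injective _ _)

theorem continuous_integersToCp : Continuous (integersToCp 𝔭) :=
  (continuous_algebraMap (LocalField 𝔭) (Cp 𝔭)).comp continuous_subtype_val

theorem splits_map_integersToCp (f : (Integers 𝔭)[X]) : (f.map (integersToCp 𝔭)).Splits := by
  have h : integersToCp 𝔭 = (UniformSpace.Completion.coeRingHom (α := AlgCl 𝔭)).comp
      ((algebraMap (LocalField 𝔭) (AlgCl 𝔭)).comp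
        (algebraMap (Integers 𝔭) (LocalField 𝔭))) := rfl
  rw [h, ← Polynomial.map_map]
  exact (IsAlgClosed.splits _).map _

/-! ### The residue field -/

variable {𝔭} {π : F[X]} (hπ : 𝔭.asIdeal = Ideal.span {π})
include hπ

theorem uniformizer_ne_zero : π ≠ 0 := by
  rintro rfl
  exact 𝔭.ne_bot (by rw [hπ, Ideal.span_singleton_eq_bot])

theorem uniformizer_irreducible : Irreducible π := by
  have h := 𝔭.isPrime
  rw [hπ, Ideal.span_singleton_prime (uniformizer_ne_zero hπ)] at h
  exact h.irreducible

theorem valuation_uniformizer :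
    Valued.v (algebraMap F[X] (Integers 𝔭) π : LocalField 𝔭) = WithZero.exp (-1 : ℤ) := by
  have h := HeightOneSpectrum.valuedAdicCompletion_eq_valuation (K := RatFunc F) 𝔭 π
  rw [HeightOneSpectrum.valuation_of_algebraMap,
    𝔭.intValuation_singleton (uniformizer_ne_zero hπ) hπ] at h
  exact h

theorem uniformizer_dvd_of_valuation_lt_one {a : Integers 𝔭}
    (ha : Valued.v (a : LocalField 𝔭) < 1) : algebraMap F[X] (Integers 𝔭) π ∣ a := by
  have hle : Valued.v (a : LocalField 𝔭) ≤
      Valued.v (algebraMap F[X] (Integers 𝔭) π : LocalField 𝔭) := by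
    rw [valuation_uniformizer hπ]
    rw [← WithZero.exp_zero] at ha
    rcases eq_or_ne (Valued.v (a : LocalField 𝔭)) 0 with h0 | h0
    · rw [h0]
      exact zero_le
    · rw [← WithZero.exp_log h0, WithZero.exp_lt_exp] at ha
      rw [← WithZero.exp_log h0, WithZero.exp_le_exp]
      omega
  exact (HeightOneSpectrum.adicCompletionIntegers.integers (RatFunc F) 𝔭).dvd_of_le hle

theorem uniformizer_dvd_or_isUnit (a : Integers 𝔭) :
    algebraMap F[X] (Integers 𝔭) π ∣ a ∨ IsUnit a := by
  have hle : Valued.v (a : LocalField 𝔭) ≤ 1 := a.2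
  rcases hle.lt_or_eq with h | h
  · exact .inl (uniformizer_dvd_of_valuation_lt_one hπ h)
  · exact .inr (HeightOneSpectrum.adicCompletionIntegers.isUnit_iff_valued_eq_one.mpr h)

omit hπ in
/-- A rational function that is integral at `𝔭` is congruent to a polynomial. -/
theorem exists_valuation_sub_lt_one {x : RatFunc F} (hx : 𝔭.valuation (RatFunc F) x ≤ 1) :
    ∃ r : F[X], 𝔭.valuation (RatFunc F) (x - algebraMap F[X] (RatFunc F) r) < 1 := by
  have hd0 : algebraMap F[X] (RatFunc F) x.denom ≠ 0 := RatFunc.algebraMap_ne_zero x.denom_ne_zero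
  have hxq : x * algebraMap F[X] (RatFunc F) x.denom = algebraMap F[X] (RatFunc F) x.num :=
    ((div_eq_iff hd0).mp x.num_div_denom).symm
  have hd : x.denom ∉ 𝔭.asIdeal := by
    intro hd
    have h1 : 𝔭.valuation (RatFunc F) (algebraMap F[X] (RatFunc F) x.num) < 1 := by
      rw [← hxq, map_mul]
      exact mul_lt_one_of_nonneg_of_lt_one_right hx zero_le
        ((𝔭.valuation_lt_one_iff_mem _).mpr hd)
    rw [𝔭.valuation_lt_one_iff_mem] at h1
    obtain ⟨a, b, hab⟩ := x.isCoprime_num_denom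
    exact 𝔭.isPrime.one_notMem (hab ▸ 𝔭.asIdeal.add_mem (𝔭.asIdeal.mul_mem_left a h1)
      (𝔭.asIdeal.mul_mem_left b hd))
  have hvd : 𝔭.valuation (RatFunc F) (algebraMap F[X] (RatFunc F) x.denom) = 1 := by
    refine le_antisymm (𝔭.valuation_le_one _) (not_lt.mp ?_)
    rwa [𝔭.valuation_lt_one_iff_mem]
  obtain ⟨e, he⟩ := 𝔭.isMaximal.exists_inv hd
  obtain ⟨i, hi, he⟩ := he
  refine ⟨x.num * e, ?_⟩
  have h2 : (x - algebraMap F[X] (RatFunc F) (x.num * e)) * algebraMap F[X] (RatFunc F) x.denom =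
      algebraMap F[X] (RatFunc F) (x.num * i) := by
    rw [sub_mul, hxq, ← map_mul, ← map_sub]
    congr 1
    linear_combination -x.num * he
  have h3 : 𝔭.valuation (RatFunc F) (algebraMap F[X] (RatFunc F) (x.num * i)) < 1 :=
    (𝔭.valuation_lt_one_iff_mem _).mpr (𝔭.asIdeal.mul_mem_left _ hi)
  rwa [← h2, map_mul, hvd, mul_one] at h3

/-- `F[T]` surjects onto the residue field. -/
theorem exists_uniformizer_dvd_sub (a : Integers 𝔭) :
    ∃ r : F[X], algebraMap F[X] (Integers 𝔭) π ∣ a - algebraMap F[X] (Integers 𝔭) r := by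
  obtain ⟨x, hx⟩ : ∃ x : RatFunc F,
      Valued.v ((a : LocalField 𝔭) - algebraMap (RatFunc F) (LocalField 𝔭) x) < 1 := by
    have hopen : IsOpen {y : LocalField 𝔭 | Valued.v ((a : LocalField 𝔭) - y) < 1} := by
      have h1 : {y : LocalField 𝔭 | Valued.v ((a : LocalField 𝔭) - y) < 1} =
          {y : LocalField 𝔭 | ‖(a : LocalField 𝔭) - y‖ < 1} := by
        ext y
        exact (Valued.toNormedField.norm_lt_one_iff (x := (a : LocalField 𝔭) - y)).symm
      rw [h1]
      exact isOpen_lt (by fun_prop) continuous_const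
    exact (HeightOneSpectrum.denseRange_algebraMap (RatFunc F) 𝔭).exists_mem_open hopen
      ⟨a, by simp⟩
  have hvx (y : RatFunc F) : Valued.v (algebraMap (RatFunc F) (LocalField 𝔭) y) =
      𝔭.valuation (RatFunc F) y :=
    HeightOneSpectrum.valuedAdicCompletion_eq_valuation' 𝔭 y
  have hx1 : 𝔭.valuation (RatFunc F) x ≤ 1 := by
    rw [← hvx]
    have h2 := Valuation.map_sub (Valued.v (R := LocalField 𝔭)) (a : LocalField 𝔭)
      ((a : LocalField 𝔭) - algebraMap (RatFunc F) (LocalField 𝔭) x)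
    rw [sub_sub_cancel] at h2
    exact h2.trans (max_le a.2 hx.le)
  obtain ⟨r, hr⟩ := exists_valuation_sub_lt_one hx1
  refine ⟨r, uniformizer_dvd_of_valuation_lt_one hπ ?_⟩
  rw [← hvx, map_sub] at hr
  have h3 : ((a - algebraMap F[X] (Integers 𝔭) r : Integers 𝔭) : LocalField 𝔭) =
      ((a : LocalField 𝔭) - algebraMap (RatFunc F) (LocalField 𝔭) x) +
      (algebraMap (RatFunc F) (LocalField 𝔭) x -
        algebraMap (RatFunc F) (LocalField 𝔭) (algebraMap F[X] (RatFunc F) r)) := by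
    rw [sub_add_sub_cancel]
    rfl
  rw [h3]
  exact (Valuation.map_add _ _ _).trans_lt (max_lt hx hr)

variable [Fintype F]

theorem uniformizer_dvd_pow_sub_self (a : Integers 𝔭) (r : ℕ) :
    algebraMap F[X] (Integers 𝔭) π ∣ a ^ Fintype.card F ^ (r * π.natDegree) - a := by
  obtain ⟨b, hb⟩ := exists_uniformizer_dvd_sub hπ a
  have hirr : Fact (Irreducible π) := ⟨uniformizer_irreducible hπ⟩
  have hπ0 := uniformizer_ne_zero hπ
  have : Module.Finite F (AdjoinRoot π) := (AdjoinRoot.powerBasis hπ0).finite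
  have : Finite (AdjoinRoot π) := Module.finite_of_finite F
  have := Fintype.ofFinite (AdjoinRoot π)
  have hcard : Fintype.card (AdjoinRoot π) = Fintype.card F ^ π.natDegree := by
    rw [Module.card_eq_pow_finrank (K := F), (AdjoinRoot.powerBasis hπ0).finrank,
      AdjoinRoot.powerBasis_dim]
  have h1 : π ∣ b ^ Fintype.card F ^ (r * π.natDegree) - b := by
    rw [← AdjoinRoot.mk_eq_zero, map_sub, map_pow, mul_comm, pow_mul, ← hcard,
      FiniteField.pow_card_pow, sub_self]
  have h2 := map_dvd (algebraMap F[X] (Integers 𝔭)) h1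
  rw [map_sub, map_pow] at h2
  have h3 := hb.trans (sub_dvd_pow_sub_pow a (algebraMap F[X] (Integers 𝔭) b)
    (Fintype.card F ^ (r * π.natDegree)))
  have h4 := dvd_sub (dvd_add h3 h2) hb
  convert h4 using 1
  ring

theorem finite_residueField : Finite (IsLocalRing.ResidueField (Integers 𝔭)) := by
  have hπ0 := uniformizer_ne_zero hπ
  have : Module.Finite F (AdjoinRoot π) := (AdjoinRoot.powerBasis hπ0).finite
  have : Finite (AdjoinRoot π) := Module.finite_of_finite F
  have hres : IsLocalRing.residue (Integers 𝔭) (algebraMap F[X] (Integers 𝔭) π) = 0 := by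
    rw [IsLocalRing.residue_eq_zero_iff, IsLocalRing.mem_maximalIdeal, mem_nonunits_iff,
      HeightOneSpectrum.adicCompletionIntegers.isUnit_iff_valued_eq_one, valuation_uniformizer hπ,
      ← WithZero.exp_zero, WithZero.exp_inj]
    omega
  let φ : AdjoinRoot π →+* IsLocalRing.ResidueField (Integers 𝔭) :=
    Ideal.Quotient.lift (Ideal.span {π})
      ((IsLocalRing.residue (Integers 𝔭)).comp (algebraMap F[X] (Integers 𝔭))) fun x hx => by
        obtain ⟨y, rfl⟩ := Ideal.mem_span_singleton.mp hx
        rw [RingHom.comp_apply, map_mul, map_mul, hres, zero_mul]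
  refine Finite.of_surjective φ fun y => ?_
  obtain ⟨a, rfl⟩ := IsLocalRing.residue_surjective y
  obtain ⟨b, c, hc⟩ := exists_uniformizer_dvd_sub hπ a
  refine ⟨AdjoinRoot.mk π b, ?_⟩
  have h1 : a = algebraMap F[X] (Integers 𝔭) b + algebraMap F[X] (Integers 𝔭) π * c := by
    rw [← hc, add_sub_cancel]
  rw [h1, map_add, map_mul, hres, zero_mul, add_zero]
  rfl

theorem compactSpace_integers : CompactSpace (Integers 𝔭) := by
  have h1 : IsDiscreteValuationRing (Valued.integer (LocalField 𝔭)) :=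
    inferInstanceAs (IsDiscreteValuationRing (Integers 𝔭))
  have h2 : Finite (IsLocalRing.ResidueField (Valued.integer (LocalField 𝔭))) :=
    finite_residueField hπ
  have h3 : CompleteSpace (Valued.integer (LocalField 𝔭)) :=
    (Valued.isClosed_integer (LocalField 𝔭)).completeSpace_coe
  exact Valued.integer.compactSpace_iff_completeSpace_and_isDiscreteValuationRing_and_finite_residueField.mpr
    ⟨h3, h1, h2⟩

end Local

/-! ### The Drinfeld module -/

namespace DrinfeldModule

section General

variable {F : Type*} [Field F] [Fintype F] {R : Type*} [CommRing R] [Algebra F[X] R]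
  (Φ : DrinfeldModule F R)

theorem coeff_zero (a : F[X]) : (Φ.toFun a).coeff 0 = 0 := by
  by_contra h
  obtain ⟨i, hi⟩ := Φ.exponent_eq a 0 h
  exact (pow_pos Fintype.card_pos i).ne hi

theorem natCast_card_eq_zero : (Fintype.card F : R) = 0 := by
  rw [← map_natCast (algebraMap F[X] R), ← map_natCast (C : F →+* F[X]),
    FiniteField.cast_card_eq_zero, map_zero, map_zero]

theorem derivative_toFun (a : F[X]) : derivative (Φ.toFun a) = C (algebraMap F[X] R a) := by
  ext n
  rw [coeff_derivative, coeff_C]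
  split_ifs with hn
  · rw [hn, zero_add, Φ.coeff_one, Nat.cast_zero, zero_add, mul_one]
  · by_cases h : (Φ.toFun a).coeff (n + 1) = 0
    · rw [h, zero_mul]
    · obtain ⟨i, hi⟩ := Φ.exponent_eq a _ h
      have hi0 : i ≠ 0 := by
        rintro rfl
        exact hn (by simpa using hi)
      rw [← Nat.cast_succ, Nat.succ_eq_add_one, hi, Nat.cast_pow, natCast_card_eq_zero,
        zero_pow hi0, mul_zero]

/-- In an algebra over `F`, the powers of the cardinality of `F` are additive exponents. -/
theorem add_pow_card {S : Type*} [CommRing S] (φ : F →+* S) (i : ℕ) (x y : S) :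
    (x + y) ^ Fintype.card F ^ i = x ^ Fintype.card F ^ i + y ^ Fintype.card F ^ i := by
  obtain ⟨n, hp, hn⟩ := FiniteField.card F (ringChar F)
  have : Fact (ringChar F).Prime := ⟨hp⟩
  rcases subsingleton_or_nontrivial S with hS | hS
  · exact Subsingleton.elim _ _
  have : CharP S (ringChar F) := (φ.charP_iff φ.injective _).mp (ringChar.charP F)
  rw [hn, ← pow_mul]
  exact add_pow_char_pow x y _ _

theorem eval₂_add {S : Type*} [CommRing S] (κ : R →+* S) (a : F[X]) (x y : S) :
    (Φ.toFun a).eval₂ κ (x + y) = (Φ.toFun a).eval₂ κ x + (Φ.toFun a).eval₂ κ y := by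
  rw [eval₂_eq_sum, eval₂_eq_sum, eval₂_eq_sum, Polynomial.sum, Polynomial.sum, Polynomial.sum,
    ← Finset.sum_add_distrib]
  refine Finset.sum_congr rfl fun n hn => ?_
  obtain ⟨i, rfl⟩ := Φ.exponent_eq a n (mem_support_iff.mp hn)
  rw [add_pow_card ((κ.comp (algebraMap F[X] R)).comp C), mul_add]

end General

variable {F : Type*} [Field F] [Fintype F] {𝔭 : HeightOneSpectrum F[X]}
  {Φ : DrinfeldModule F (Integers 𝔭)} {π : F[X]} {r : ℕ}

/-- Equality of rank and height means that the lowest and the highest power of `x` in `Φ_π` modulo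
the maximal ideal coincide. -/
theorem isFrobeniusType (hπ : 𝔭.asIdeal = Ideal.span {π}) (hr : 1 < r) (hrank : Φ.HasRank r)
    (hheight : Φ.HasHeight π r) (hmonic : (Φ.toFun π).Monic) :
    IsFrobeniusType (integersToCp 𝔭) (algebraMap F[X] (Integers 𝔭) π) (Φ.toFun π) := by
  have hdeg := hrank π (uniformizer_ne_zero hπ)
  have hlt : Valued.v (algebraMap F[X] (Integers 𝔭) π : LocalField 𝔭) < 1 := by
    rw [valuation_uniformizer hπ, ← WithZero.exp_zero, WithZero.exp_lt_exp]
    omega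
  have hnu : ¬ IsUnit (algebraMap F[X] (Integers 𝔭) π) := fun h =>
    hlt.ne (HeightOneSpectrum.adicCompletionIntegers.isUnit_iff_valued_eq_one.mp h)
  exact
  { norm_le_one := norm_integersToCp_le_one 𝔭
    injective := integersToCp_injective 𝔭
    ne_zero := fun h => by
      have h1 := valuation_uniformizer hπ
      rw [h, ZeroMemClass.coe_zero, map_zero] at h1
      exact WithZero.exp_ne_zero h1.symm
    norm_lt_one := by
      rw [norm_integersToCp]
      exact Valued.toNormedField.norm_lt_one_iff.mpr hlt
    dvd_or_isUnit := uniformizer_dvd_or_isUnit hπ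
    dvd_pow_sub_self := fun a => by
      rw [hdeg]
      exact uniformizer_dvd_pow_sub_self hπ a r
    add_pow := fun x y => by
      rw [hdeg]
      exact add_pow_card (((integersToCp 𝔭).comp (algebraMap F[X] (Integers 𝔭))).comp C) _ x y
    monic := hmonic
    two_lt := by
      have h1 : 1 < Fintype.card F := Fintype.one_lt_card
      have h2 : 0 < π.natDegree := (uniformizer_irreducible hπ).natDegree_pos
      have h3 : 2 ≤ r * π.natDegree := by nlinarith
      calc 2 < 2 ^ 2 := by norm_num
        _ ≤ Fintype.card F ^ 2 := Nat.pow_le_pow_left h1 2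
        _ ≤ Fintype.card F ^ (r * π.natDegree) := Nat.pow_le_pow_right (by omega) h3
        _ = _ := hdeg.symm
    coeff_zero := Φ.coeff_zero π
    derivative_eq := Φ.derivative_toFun π
    dvd_coeff := fun i hi => by
      refine (uniformizer_dvd_or_isUnit hπ _).resolve_right fun hu => ?_
      rw [hdeg] at hi
      have h1 := coeff_eq_zero_of_lt_natTrailingDegree (hi.trans_eq hheight.symm)
      rw [coeff_map] at h1
      exact (hu.map (IsLocalRing.residue (Integers 𝔭))).ne_zero h1
    eval_add := Φ.eval₂_add (integersToCp 𝔭) π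
    splits := splits_map_integersToCp 𝔭 _ }

theorem act_mul (Φ : DrinfeldModule F (Integers 𝔭)) (a b : F[X]) (z : Cp 𝔭) :
    Φ.act (a * b) z = Φ.act a (Φ.act b z) := by
  rw [act, Φ.map_mul, eval₂_comp]
  rfl

theorem act_zero_right (Φ : DrinfeldModule F (Integers 𝔭)) (a : F[X]) : Φ.act a 0 = 0 := by
  rw [act, eval₂_at_zero, Φ.coeff_zero, map_zero]

theorem mem_torsion_iff (Φ : DrinfeldModule F (Integers 𝔭)) (hπ : 𝔭.asIdeal = Ideal.span {π})
    {u : Cp 𝔭} : u ∈ Φ.torsion ↔ Φ.act π u = 0 := by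
  refine ⟨fun h => h π (hπ ▸ Ideal.mem_span_singleton_self π), fun h a ha => ?_⟩
  rw [hπ] at ha
  obtain ⟨b, rfl⟩ := Ideal.mem_span_singleton'.mp ha
  rw [act_mul, h, act_zero_right]

theorem torsion_eq_zeros (hπ : 𝔭.asIdeal = Ideal.span {π})
    (H : IsFrobeniusType (integersToCp 𝔭) (algebraMap F[X] (Integers 𝔭) π) (Φ.toFun π)) :
    Φ.torsion = ↑(zeros (integersToCp 𝔭) (Φ.toFun π)) := by
  ext u
  rw [Φ.mem_torsion_iff hπ, Finset.mem_coe, H.mem_zeros]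
  rfl

end DrinfeldModule

/-! ### The functional equation of the norm -/

section Series

variable {F : Type*} [Field F] {𝔭 : HeightOneSpectrum F[X]}

theorem convergesOnPuncturedBall_toFieldSeries (g : (Integers 𝔭)⸨X⸩) :
    ConvergesOnPuncturedBall (toFieldSeries g) := fun _ hz0 hz =>
  summable_lsEval (norm_integersToCp_le_one 𝔭) hz0 hz g

/-- The points `f(ϖ ^ (j + 1))` are nonzero and tend to `0`. They serve to test the vanishing of
Laurent series. -/
theorem IsFrobeniusType.norm_eval_uniformizer_pow {O 𝕜 : Type*} [CommRing O] [NormedField 𝕜]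
    [IsUltrametricDist 𝕜] {ι : O →+* 𝕜} {ϖ : O} {f : O[X]} (H : IsFrobeniusType ι ϖ f) (j : ℕ) :
    ‖f.eval₂ ι (ι ϖ ^ (j + 1))‖ = ‖ι ϖ‖ ^ (j + 2) := by
  have hz : ‖ι ϖ ^ (j + 1)‖ < 1 := by
    rw [norm_pow]
    exact pow_lt_one₀ (norm_nonneg _) H.norm_lt_one j.succ_ne_zero
  have h1 := H.norm_eval_sub_pow hz
  rw [norm_pow, ← pow_succ'] at h1
  have h2 : ‖(ι ϖ ^ (j + 1)) ^ f.natDegree‖ < ‖ι ϖ‖ ^ (j + 2) := by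
    rw [norm_pow, norm_pow, ← pow_mul]
    refine H.pow_strictAnti ?_
    have := H.two_lt
    nlinarith
  rw [← h1] at h2 ⊢
  have h3 := IsUltrametricDist.norm_add_eq_max_of_norm_ne_norm h2.ne'
  rwa [sub_add_cancel, max_eq_left h2.le] at h3

end Series

section ColemanNorm

variable {F : Type*} [Field F] [Fintype F] {𝔭 : HeightOneSpectrum F[X]}
  {Φ : DrinfeldModule F (Integers 𝔭)} {π : F[X]}

/-- The functional equation determines the values of the norm of `g` at the points
`Φ_π(π ^ (j + 1))`, which tend to `0`, and thereby the series. -/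
theorem IsColemanNorm.unique (hπ : 𝔭.asIdeal = Ideal.span {π})
    (H : IsFrobeniusType (integersToCp 𝔭) (algebraMap F[X] (Integers 𝔭) π) (Φ.toFun π))
    {g h h' : (LocalField 𝔭)⸨X⸩} (hh : IsColemanNorm Φ π g h) (hh' : IsColemanNorm Φ π g h') :
    h = h' := by
  set ϖ : Cp 𝔭 := integersToCp 𝔭 (algebraMap F[X] (Integers 𝔭) π)
  let s (j : ℕ) : Cp 𝔭 := Φ.act π (ϖ ^ (j + 1))
  have hs (j : ℕ) : ‖s j‖ = ‖ϖ‖ ^ (j + 2) := H.norm_eval_uniformizer_pow j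
  have hs0 (j : ℕ) : s j ≠ 0 := by
    rw [← norm_pos_iff, hs]
    exact pow_pos H.norm_pos _
  have hs1 (j : ℕ) : ‖s j‖ < 1 := by
    rw [hs]
    exact pow_lt_one₀ (norm_nonneg _) H.norm_lt_one (by omega)
  have hsum {z : Cp 𝔭} (hz0 : z ≠ 0) (hz : ‖z‖ < 1) :
      HasSum (fun i : ℤ => algebraMap (LocalField 𝔭) (Cp 𝔭) ((h - h').coeff i) * z ^ i)
        (evalAt h z - evalAt h' z) := by
    simp only [HahnSeries.coeff_sub, map_sub, sub_mul]
    exact (hh.1 z hz0 hz).hasSum.sub (hh'.1 z hz0 hz).hasSum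
  refine sub_eq_zero.mp (eq_zero_of_lsEval_eq_zero (algebraMap (LocalField 𝔭) (Cp 𝔭)).injective
    (hs0 0) (hsum (hs0 0) (hs1 0)).summable hs0 ?_ (fun j => (hsum (hs0 j) (hs1 j)).summable)
    fun j => ?_)
  · rw [tendsto_zero_iff_norm_tendsto_zero]
    simp only [hs]
    exact (tendsto_pow_atTop_nhds_zero_of_lt_one (norm_nonneg _) H.norm_lt_one).comp
      (Filter.tendsto_add_atTop_nat 2)
  · have hz : ‖ϖ ^ (j + 1)‖ < 1 := by
      rw [norm_pow]
      exact pow_lt_one₀ (norm_nonneg _) H.norm_lt_one j.succ_ne_zero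
    have hnt : ϖ ^ (j + 1) ∉ Φ.torsion := by
      rw [Φ.mem_torsion_iff hπ]
      exact hs0 j
    refine (hsum (hs0 j) (hs1 j)).tsum_eq.trans ?_
    rw [sub_eq_zero, hh.2 _ hz hnt, hh'.2 _ hz hnt]

theorem isColemanNorm_lsNorm (hπ : 𝔭.asIdeal = Ideal.span {π})
    (H : IsFrobeniusType (integersToCp 𝔭) (algebraMap F[X] (Integers 𝔭) π) (Φ.toFun π))
    {θ : ℕ → Cp 𝔭} (hθ : IsTorsionSequence (integersToCp 𝔭) (Φ.toFun π) θ)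
    [IsAdicComplete (Ideal.span {algebraMap F[X] (Integers 𝔭) π}) (Integers 𝔭)]
    (g : ((Integers 𝔭)⸨X⸩)ˣ) :
    IsColemanNorm Φ π (toFieldSeries g.val) (toFieldSeries (lsNorm H hθ g).val) := by
  refine ⟨convergesOnPuncturedBall_toFieldSeries _, fun z hz hzt => ?_⟩
  rw [Φ.mem_torsion_iff hπ] at hzt
  rw [DrinfeldModule.torsion_eq_zeros hπ H, finprod_mem_coe_finset]
  exact lsEval_lsNorm H hθ g hz hzt

end ColemanNorm

/-! ### The tower of torsion points -/

section Tower

variable {F : Type*} [Field F] [Fintype F] {𝔭 : HeightOneSpectrum F[X]}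
  {Φ : DrinfeldModule F (Integers 𝔭)} {π : F[X]}

theorem isTorsionSequence {ω : ℕ → Cp 𝔭}
    (hω : ∀ n, 1 ≤ n → (Φ.act π)^[n] (ω n) = 0 ∧ (Φ.act π)^[n - 1] (ω n) ≠ 0)
    (hω' : ∀ n, 1 ≤ n → Φ.act π (ω (n + 1)) = ω n) :
    IsTorsionSequence (integersToCp 𝔭) (Φ.toFun π) fun n => ω (n + 1) where
  ne_zero := (hω 1 le_rfl).2
  eval_zero := (hω 1 le_rfl).1
  eval_succ n := hω' (n + 1) n.succ_pos

omit [Fintype F] in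
theorem eval₂_integersToCp_mem (L : IntermediateField (LocalField 𝔭) (Cp 𝔭))
    (f : (Integers 𝔭)[X]) {z : Cp 𝔭} (hz : z ∈ L) : f.eval₂ (integersToCp 𝔭) z ∈ L := by
  rw [eval₂_eq_sum]
  exact sum_mem fun i _ => mul_mem (L.algebraMap_mem _) (pow_mem hz i)

/-- As `Φ_π(ω_{n+1}) = ω_n`, the `n`-th field of the tower is generated by `ω_n` alone. -/
theorem tower_eq_adjoin {ω : ℕ → Cp 𝔭} (hω' : ∀ n, 1 ≤ n → Φ.act π (ω (n + 1)) = ω n) (n : ℕ) :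
    tower ω (n + 1) = IntermediateField.adjoin (LocalField 𝔭) {ω (n + 1)} := by
  have hmem (n : ℕ) : ω (n + 1) ∈ tower ω (n + 1) :=
    IntermediateField.mem_adjoin_simple_self (tower ω n) (ω (n + 1))
  refine le_antisymm ?_ (IntermediateField.adjoin_simple_le_iff.mpr (hmem n))
  have key (n : ℕ) (hle : tower ω n ≤ IntermediateField.adjoin (LocalField 𝔭) {ω (n + 1)}) :
      tower ω (n + 1) ≤ IntermediateField.adjoin (LocalField 𝔭) {ω (n + 1)} := by
    have h : IntermediateField.adjoin (tower ω n) {ω (n + 1)} ≤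
        IntermediateField.extendScalars hle :=
      IntermediateField.adjoin_simple_le_iff.mpr ((IntermediateField.mem_extendScalars hle).mpr
        (IntermediateField.mem_adjoin_simple_self (LocalField 𝔭) (ω (n + 1))))
    exact fun x hx => h hx
  induction n with
  | zero => exact key 0 bot_le
  | succ n ih =>
    refine key (n + 1) (ih.trans (IntermediateField.adjoin_simple_le_iff.mpr ?_))
    rw [← hω' (n + 1) n.succ_pos]
    exact eval₂_integersToCp_mem _ _ (IntermediateField.mem_adjoin_simple_self _ _)

end Tower

end DrinfeldColeman

end

open DrinfeldColeman in
theorem mainTheorem7 {F : Type*} [Field F] [Fintype F]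
    (𝔭 : HeightOneSpectrum F[X]) (π : F[X]) (hπ : 𝔭.asIdeal = Ideal.span {π})
    (r : ℕ) (hr : 1 < r)
    (Φ : DrinfeldModule F (Integers 𝔭)) (hrank : Φ.HasRank r)
    (hgood : Φ.HasGoodReduction) (hheight : Φ.HasHeight π r)
    (hmonic : (Φ.toFun π).Monic)
    (ω : ℕ → Cp 𝔭)
    (hω : ∀ n, 1 ≤ n → (Φ.act π)^[n] (ω n) = 0 ∧ (Φ.act π)^[n - 1] (ω n) ≠ 0)
    (hω' : ∀ n, 1 ≤ n → Φ.act π (ω (n + 1)) = ω n) :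
    ∃ N : ((Integers 𝔭)⸨X⸩)ˣ →* ((Integers 𝔭)⸨X⸩)ˣ,
      (∀ (g : ((Integers 𝔭)⸨X⸩)ˣ) (h : (LocalField 𝔭)⸨X⸩),
        IsColemanNorm Φ π (toFieldSeries g.val) h ↔ h = toFieldSeries (N g).val) ∧
      ∃ ev : N.eqLocus (MonoidHom.id _) ≃* normLimit ω,
        ∀ (f : N.eqLocus (MonoidHom.id _)) (n : ℕ),
          (((ev f).val n).val : Cp 𝔭) = evalAt (toFieldSeries f.val.val) (ω (n + 1)) := by
  have H := DrinfeldModule.isFrobeniusType hπ hr hrank hheight hmonic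
  have hθ := isTorsionSequence hω hω'
  have : CompactSpace (Integers 𝔭) := compactSpace_integers hπ
  have hcont := continuous_integersToCp 𝔭
  have := H.isAdicComplete hcont
  refine ⟨lsNorm H hθ, fun g h => ⟨fun hh => ?_, ?_⟩, ?_⟩
  · exact hh.unique hπ H (isColemanNorm_lsNorm hπ H hθ g)
  · rintro rfl
    exact isColemanNorm_lsNorm hπ H hθ g
  · have T := isNormTower (K := LocalField 𝔭) H hθ (L := fun n => tower ω (n + 1))
      (tower_eq_adjoin hω') fun n => tower_le_succ ω (n + 1)
    exact exists_evalUnits_mulEquiv H hθ T hcont (normLimit ω) fun a => Iff.rfl
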